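/- Let $d\ge 1$, $0<\alpha<d$, and let $\Omega\subset\mathbb R^d$ be a domain (non-empty connected open set) of finite Lebesgue measure $|\Omega|$. Let $K:\mathbb R^d\to\mathbb C$ be a locally integrable function which is homogeneous of order $\alpha-d$, i.e. $K(tx)=t^{\alpha-d}K(x)$ for all $t>0$, $x\ne0$, and satisfies $K(x)=\overline{K(-x)}$ for $x\neq 0$. Suppose that its Fourier transform $\widehat K(\xi)=\int_{\mathbb R^d}e^{-ix\cdot\xi}K(x)\,dx$, in the sense of distributions, is a locally integrable function. Consider in $L^2(\Omega)$ the integral operator $$\mathcal K u(x)=\int_\Omega K(x-y)\,u(y)\,dy .$$ (i) If $K$ is bounded on the unit sphere (for example, if $K$ is continuous on $\mathbb R^d\setminus\{0\}$), then $\mathcal K$ is a well-defined compact operator on $L^2(\Omega)$, the integral converging absolutely for almost every $x\in\Omega$. (ii) Whenever $\mathcal K$ is a well-defined bounded operator on $L^2(\Omega)$ (the integral converging absolutely for almost every $x\in\Omega$, for each $u\in L^2(\Omega)$), it is self-adjoint, and for every $\lambda>0$ its eigenvalues $\lambda_k^{\pm}$ (positive and negative together, repeated according to multiplicity) satisfy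 $$\sum_k\bigl(|\lambda_k^\pm|-\lambda\bigr)_+\ \le\ (2\pi)^{-d}\,|\Omega|\,\lambda^{1-\frac d\alpha}\int_{\mathbb R^d}\bigl(|\widehat K(\xi)|-1\bigr)_+\,d\xi ,$$ where the right-hand side may be $+\infty$. -/

import Mathlib

open MeasureTheory
open scoped ENNReal ContDiff

/-- The Hilbert space `L²(Ω)` of complex-valued functions on `Ω ⊆ ℝ^d` (Lebesgue measure). -/
abbrev L2 {d : ℕ} (Ω : Set (EuclideanSpace ℝ (Fin d))) : Type :=
  Lp ℂ 2 (volume.restrict Ω)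

/-- `K(t x) = t^s K(x)` for all `t > 0` and `x ≠ 0`. -/
def IsHomogeneousOfOrder {d : ℕ} (s : ℝ) (K : EuclideanSpace ℝ (Fin d) → ℂ) : Prop :=
  ∀ t : ℝ, 0 < t → ∀ x, x ≠ 0 → K (t • x) = ((t ^ s : ℝ) : ℂ) * K x

/-- The Fourier transform `∫ exp(-i x·ξ) φ(x) dx` of a test function. -/
noncomputable def testFourier {d : ℕ} (φ : EuclideanSpace ℝ (Fin d) → ℂ)
    (ξ : EuclideanSpace ℝ (Fin d)) : ℂ :=
  ∫ x, Complex.exp (-Complex.I * ((inner ℝ x ξ : ℝ) : ℂ)) * φ x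

/-- The Fourier transform of `K`, in the sense of distributions, is the locally integrable
function `Khat`: the distribution `φ ↦ ∫ K φ̂` is given on all `φ ∈ C_c^∞(ℝ^d)` by
`φ ↦ ∫ Khat φ`. (Since `C_c^∞` is dense in the Schwartz space, this determines
the tempered distribution.) -/
def IsDistributionalFourierTransform {d : ℕ} (K Khat : EuclideanSpace ℝ (Fin d) → ℂ) : Prop :=
  LocallyIntegrable Khat volume ∧
    ∀ φ : EuclideanSpace ℝ (Fin d) → ℂ, ContDiff ℝ ∞ φ → HasCompactSupport φ →
      ∫ x, K x * testFourier φ x = ∫ ξ, Khat ξ * φ ξ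

/-- `T` is the integral operator `(T u)(x) = ∫_Ω K(x - y) u(y) dy` on `L²(Ω)`, the integral
converging absolutely for almost every `x ∈ Ω`. -/
def IsConvolutionOperator {d : ℕ} (Ω : Set (EuclideanSpace ℝ (Fin d)))
    (K : EuclideanSpace ℝ (Fin d) → ℂ) (T : L2 Ω →L[ℂ] L2 Ω) : Prop :=
  ∀ u : L2 Ω, ∀ᵐ x ∂(volume.restrict Ω),
    IntegrableOn (fun y => K (x - y) * u y) Ω volume ∧
      (T u : EuclideanSpace ℝ (Fin d) → ℂ) x = ∫ y in Ω, K (x - y) * u y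

/-- The (geometric) multiplicity of `μ` as an eigenvalue of `T`; it is `0` if `μ` is not an
eigenvalue. -/
noncomputable def eigenMultiplicity {H : Type*} [NormedAddCommGroup H] [NormedSpace ℂ H]
    (T : H →L[ℂ] H) (μ : ℂ) : ℕ∞ :=
  Cardinal.toENat (Module.rank ℂ (Module.End.eigenspace (T : H →ₗ[ℂ] H) μ))

/-- The Riesz mean `∑ₖ (|λₖ| - lam)₊` over all eigenvalues of `T`, each repeated according to its
multiplicity. -/
noncomputable def rieszMean {H : Type*} [NormedAddCommGroup H] [NormedSpace ℂ H]
    (T : H →L[ℂ] H) (lam : ℝ) : ℝ≥0∞ :=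
  ∑' μ : ℂ, (eigenMultiplicity T μ : ℝ≥0∞) * ENNReal.ofReal (‖μ‖ - lam)

/-! ### Growth of the homogeneous kernel. -/

section Kernel

open MeasureTheory Filter Topology Set
open scoped ENNReal ContDiff

/-! Extend `u ∈ L²(Ω)` by zero and let `û(ξ)` be its inner product with the plane wave `e^{iy·ξ}` on
`Ω`. Formally `⟪u, T u⟫ = (2π)^{-d} ∫ Khat |û|²`, so `|Khat| ≤ (|Khat| - λ)₊ + λ` and Plancherel
give `|⟪u, T u⟫| ≤ (2π)^{-d} ∫ (|Khat| - λ)₊ |û|² + λ ‖u‖²`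
(`IsConvolutionOperator.enorm_inner_le`). For a normalized eigenvector this bounds `|λ_k| - λ`.
Summing over an orthonormal family of eigenvectors, Bessel's inequality for the plane wave yields `∑
|û_k(ξ)|² ≤ ‖e^{iy·ξ}‖² = |Ω|` (`sum_spectralForm_le`). Finally `Khat` is homogeneous of order `-α`,
and a dilation extracts the power of `λ`.

The formal identity needs care, because `Khat` is only locally integrable while `|û|²` is not
compactly supported. For test functions `u`, the pairing with `|û|²` is a limit of pairings with
truncations; an inequality survives the limit, and it suffices
(`IsDistributionalFourierTransform.enorm_integral_le`). Density then reaches all of `L²(Ω)`, since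
the form with weight `(|Khat| - λ)₊` is continuous when that weight is integrable; when it is not,
the bound is trivial.

For compactness, cut `K` at radius `r`: the singular part has norm `O(r^α)` by Schur's test, the
rest is bounded and hence Hilbert–Schmidt on a set of finite measure. -/

theorem lintegral_comp_smul_eq {E : Type*} [NormedAddCommGroup E] [NormedSpace ℝ E]
    [MeasurableSpace E] [BorelSpace E] [FiniteDimensional ℝ E] (μ : Measure E)
    [μ.IsAddHaarMeasure] (f : E → ℝ≥0∞) {t : ℝ} (ht : 0 < t) :
    ∫⁻ x, f (t • x) ∂μ = ENNReal.ofReal ((t ^ Module.finrank ℝ E)⁻¹) * ∫⁻ x, f x ∂μ := by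
  have h := lintegral_map_equiv (μ := μ) f (Homeomorph.smulOfNeZero t ht.ne').toMeasurableEquiv
  have h2 : Measure.map (⇑(Homeomorph.smulOfNeZero (α := E) t ht.ne').toMeasurableEquiv) μ
      = ENNReal.ofReal |(t ^ Module.finrank ℝ E)⁻¹| • μ :=
    Measure.map_addHaar_smul μ ht.ne'
  rw [h2, lintegral_smul_measure, abs_of_pos (by positivity)] at h
  exact h.symm

theorem ae_ne_zero_of_pos_dim {d : ℕ} (hd : 1 ≤ d) :
    ∀ᵐ x : EuclideanSpace ℝ (Fin d), x ≠ 0 := by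
  have : Nonempty (Fin d) := ⟨⟨0, hd⟩⟩
  exact compl_mem_ae_iff.2 (measure_singleton (0 : EuclideanSpace ℝ (Fin d)))

theorem IsHomogeneousOfOrder.setLIntegral_ball {d : ℕ} (hd : 1 ≤ d) {α : ℝ}
    {K : EuclideanSpace ℝ (Fin d) → ℂ} (hK : IsHomogeneousOfOrder (α - d) K)
    {t : ℝ} (ht : 0 < t) :
    ∫⁻ x in Metric.ball 0 t, ‖K x‖ₑ = ENNReal.ofReal (t ^ α) *
      ∫⁻ x in Metric.ball 0 1, ‖K x‖ₑ := by
  have h := lintegral_comp_smul_eq (volume : Measure (EuclideanSpace ℝ (Fin d)))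
    ((Metric.ball 0 t).indicator fun x => ‖K x‖ₑ) ht
  have h2 : ∫⁻ x, (Metric.ball 0 t).indicator (fun x => ‖K x‖ₑ) (t • x) =
      ENNReal.ofReal (t ^ (α - d)) *
        ∫⁻ x : EuclideanSpace ℝ (Fin d), (Metric.ball 0 1).indicator (fun x => ‖K x‖ₑ) x := by
    rw [← lintegral_const_mul' _ _ ENNReal.ofReal_ne_top]
    refine lintegral_congr_ae ?_
    filter_upwards [ae_ne_zero_of_pos_dim hd] with x hx
    have : t • x ∈ Metric.ball 0 t ↔ x ∈ Metric.ball 0 1 := by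
      simp [norm_smul, abs_of_pos ht, ht]
    by_cases hx1 : x ∈ Metric.ball 0 1
    · rw [indicator_of_mem (this.2 hx1), indicator_of_mem hx1, hK t ht x hx, enorm_mul,
        ← ofReal_norm, Complex.norm_real, Real.norm_of_nonneg (by positivity)]
    · rw [indicator_of_notMem (this.not.2 hx1), indicator_of_notMem hx1, mul_zero]
  rw [h2, lintegral_indicator Metric.isOpen_ball.measurableSet,
    lintegral_indicator Metric.isOpen_ball.measurableSet, finrank_euclideanSpace_fin] at h
  have h3 : ENNReal.ofReal (t ^ (d : ℝ)) * ENNReal.ofReal ((t ^ d)⁻¹) = 1 := by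
    rw [← ENNReal.ofReal_mul (by positivity), Real.rpow_natCast,
      mul_inv_cancel₀ (by positivity), ENNReal.ofReal_one]
  calc _ = ENNReal.ofReal (t ^ (d : ℝ)) * (ENNReal.ofReal ((t ^ d)⁻¹) *
        ∫⁻ x in Metric.ball 0 t, ‖K x‖ₑ) := by rw [← mul_assoc, h3, one_mul]
    _ = _ := by
      rw [← h, ← mul_assoc, ← ENNReal.ofReal_mul (by positivity), ← Real.rpow_add ht]
      ring_nf

/-- A single term suffices: for the least `n` with `‖x‖ < 2 ^ n` one has `2 ^ n ≤ 2 * (1 + ‖x‖)`. -/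
theorem inv_one_add_pow_le_tsum_indicator {E : Type*} [SeminormedAddCommGroup E] (d : ℕ) (x : E) :
    ENNReal.ofReal (((1 + ‖x‖) ^ d)⁻¹) ≤ ∑' n : ℕ, (Metric.ball (0 : E) (2 ^ n)).indicator
      (fun _ => ENNReal.ofReal (2 ^ d * (((2 : ℝ) ^ n) ^ d)⁻¹)) x := by
  classical
  have hex : ∃ n : ℕ, ‖x‖ < 2 ^ n := pow_unbounded_of_one_lt _ one_lt_two
  set n := Nat.find hex with hn
  have h1 : ‖x‖ < 2 ^ n := Nat.find_spec hex
  refine le_trans ?_ (ENNReal.le_tsum n)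
  rw [indicator_of_mem (by simpa using h1)]
  apply ENNReal.ofReal_le_ofReal
  have h2 : (2 : ℝ) ^ n ≤ 2 * (1 + ‖x‖) := by
    rcases hm : n with _ | m
    · simp; linarith [norm_nonneg x]
    · have : ¬ ‖x‖ < 2 ^ m := Nat.find_min hex (by omega)
      rw [pow_succ]; linarith
  rw [← inv_inv ((2 : ℝ) ^ d), ← mul_inv]
  apply inv_anti₀ (by positivity)
  rw [← div_eq_inv_mul, ← div_pow]
  exact pow_le_pow_left₀ (by positivity) (by linarith) _

/-- By homogeneity the dyadic balls contribute a geometric series of ratio `2 ^ (α - d) < 1`. This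
makes `K` tempered: it pairs absolutely with anything decaying like `(1 + ‖x‖) ^ (-d)`. -/
theorem IsHomogeneousOfOrder.integrable_weight {d : ℕ} (hd : 1 ≤ d) {α : ℝ}
    (hαd : α < d) {K : EuclideanSpace ℝ (Fin d) → ℂ}
    (hKloc : LocallyIntegrable K volume) (hK : IsHomogeneousOfOrder (α - d) K) :
    Integrable (fun x => ‖K x‖ * ((1 + ‖x‖) ^ d)⁻¹) volume := by
  have hmeas : AEStronglyMeasurable K volume := hKloc.aestronglyMeasurable
  refine ⟨hmeas.norm.mul (by fun_prop (disch := intros; positivity)), ?_⟩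
  set I := ∫⁻ x in Metric.ball (0 : EuclideanSpace ℝ (Fin d)) 1, ‖K x‖ₑ
  have hI : I < ⊤ :=
    ((hKloc.integrableOn_isCompact (isCompact_closedBall 0 1)).mono_set
      Metric.ball_subset_closedBall).2
  set c : ℕ → ℝ≥0∞ := fun n => ENNReal.ofReal (2 ^ d * (((2 : ℝ) ^ n) ^ d)⁻¹)
  have key : ∫⁻ x, ‖‖K x‖ * ((1 + ‖x‖) ^ d)⁻¹‖ₑ ≤ ∑' n : ℕ, c n *
      (ENNReal.ofReal (((2 : ℝ) ^ n) ^ α) * I) := by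
    calc _ ≤ ∫⁻ x, ∑' n : ℕ, (Metric.ball (0 : EuclideanSpace ℝ (Fin d)) (2 ^ n)).indicator
            (fun x => c n * ‖K x‖ₑ) x := by
          refine lintegral_mono fun x => ?_
          rw [enorm_mul, enorm_norm, mul_comm, Real.enorm_of_nonneg (by positivity)]
          refine (mul_le_mul_left (inv_one_add_pow_le_tsum_indicator d x) _).trans ?_
          rw [← ENNReal.tsum_mul_right]
          refine ENNReal.tsum_le_tsum fun n => ?_
          by_cases hx : x ∈ Metric.ball (0 : EuclideanSpace ℝ (Fin d)) (2 ^ n)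
          · simp only [indicator_of_mem hx]; exact le_rfl
          · simp only [indicator_of_notMem hx, zero_mul]; exact le_rfl
      _ = ∑' n : ℕ, ∫⁻ x, (Metric.ball (0 : EuclideanSpace ℝ (Fin d)) (2 ^ n)).indicator
            (fun x => c n * ‖K x‖ₑ) x := by
          refine lintegral_tsum fun n => ?_
          exact (hmeas.enorm.const_mul _).indicator Metric.isOpen_ball.measurableSet
      _ ≤ _ := by
          refine ENNReal.tsum_le_tsum fun n => ?_
          rw [lintegral_indicator Metric.isOpen_ball.measurableSet,
            lintegral_const_mul' _ _ ENNReal.ofReal_ne_top, hK.setLIntegral_ball hd (by positivity)]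
  refine key.trans_lt ?_
  have h4 : ∀ n : ℕ, c n * (ENNReal.ofReal (((2 : ℝ) ^ n) ^ α) * I) =
      ENNReal.ofReal (2 ^ d) * I * (ENNReal.ofReal (2 ^ (α - d))) ^ n := by
    intro n
    rw [← mul_assoc, ← ENNReal.ofReal_mul (by positivity), ← ENNReal.ofReal_pow (by positivity),
      mul_right_comm _ I, ← ENNReal.ofReal_mul (by positivity), mul_assoc (2 ^ d : ℝ)]
    congr 3
    rw [← Real.rpow_natCast, ← Real.rpow_natCast, ← Real.rpow_natCast, ← Real.rpow_mul (by norm_num),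
      ← Real.rpow_mul (by norm_num), ← Real.rpow_neg (by norm_num), ← Real.rpow_mul (by norm_num),
      ← Real.rpow_add (by norm_num)]
    ring_nf
  simp_rw [h4]
  rw [ENNReal.tsum_mul_left, ENNReal.tsum_geometric]
  refine ENNReal.mul_lt_top (ENNReal.mul_lt_top ENNReal.ofReal_lt_top hI) ?_
  rw [ENNReal.inv_lt_top, tsub_pos_iff_lt, ENNReal.ofReal_lt_one]
  exact Real.rpow_lt_one_of_one_lt_of_neg one_lt_two (by linarith)

end Kernel

/-! ### From compactly supported to Schwartz test functions. -/

section FourierBound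

open MeasureTheory Filter Topology Set
open scoped ENNReal ContDiff SchwartzMap FourierTransform

theorem testFourier_eq_fourier {d : ℕ} (φ : EuclideanSpace ℝ (Fin d) → ℂ)
    (x : EuclideanSpace ℝ (Fin d)) :
    testFourier φ x = 𝓕 φ ((2 * Real.pi)⁻¹ • x) := by
  rw [Real.fourier_eq', testFourier]
  refine integral_congr_ae (Eventually.of_forall fun v => ?_)
  simp only [inner_smul_right, smul_eq_mul]
  congr 2
  have : (Real.pi : ℂ) ≠ 0 := by exact_mod_cast Real.pi_ne_zero
  push_cast
  field_simp

section Cutoff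

variable {E : Type*} [NormedAddCommGroup E] [InnerProductSpace ℝ E] [FiniteDimensional ℝ E]

/-- A smooth cutoff function, equal to `1` on the unit ball and supported in the ball of
radius `2`. -/
noncomputable def cutoff (E : Type*) [NormedAddCommGroup E] [InnerProductSpace ℝ E]
    [FiniteDimensional ℝ E] : ContDiffBump (0 : E) :=
  ⟨1, 2, one_pos, one_lt_two⟩

/-- The cutoff function as a Schwartz function. -/
noncomputable def cutoffSchwartz (E : Type*) [NormedAddCommGroup E] [InnerProductSpace ℝ E]
    [FiniteDimensional ℝ E] : 𝓢(E, ℂ) :=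
  HasCompactSupport.toSchwartzMap (f := fun x => ((cutoff E x : ℝ) : ℂ))
    ((cutoff E).hasCompactSupport.comp_left Complex.ofReal_zero)
    (Complex.ofRealCLM.contDiff.comp (cutoff E).contDiff)

theorem cutoffSchwartz_apply (x : E) : cutoffSchwartz E x = ((cutoff E x : ℝ) : ℂ) := rfl

theorem norm_cutoffSchwartz_le_one (x : E) : ‖cutoffSchwartz E x‖ ≤ 1 := by
  rw [cutoffSchwartz_apply, Complex.norm_real, Real.norm_of_nonneg (cutoff E).nonneg]
  exact (cutoff E).le_one

theorem hasCompactSupport_cutoffSchwartz : HasCompactSupport (cutoffSchwartz E) :=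
  (cutoff E).hasCompactSupport.comp_left Complex.ofReal_zero

theorem hasCompactSupport_truncate (φ : 𝓢(E, ℂ)) (n : ℕ) :
    HasCompactSupport fun x => cutoffSchwartz E ((n + 1 : ℝ)⁻¹ • x) * φ x :=
  (hasCompactSupport_cutoffSchwartz.comp_smul (c := ((n : ℝ) + 1)⁻¹) (by positivity)).mul_right

theorem contDiff_truncate (φ : 𝓢(E, ℂ)) (n : ℕ) :
    ContDiff ℝ ∞ fun x => cutoffSchwartz E ((n + 1 : ℝ)⁻¹ • x) * φ x :=
  (((cutoffSchwartz E).smooth ⊤).comp (contDiff_const_smul _)).mul (φ.smooth ⊤)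

/-- The product of `φ` with a dilated cutoff function. -/
noncomputable def truncate (φ : 𝓢(E, ℂ)) (n : ℕ) : 𝓢(E, ℂ) :=
  (hasCompactSupport_truncate φ n).toSchwartzMap (contDiff_truncate φ n)

theorem truncate_apply (φ : 𝓢(E, ℂ)) (n : ℕ) (x : E) :
    truncate φ n x = cutoffSchwartz E ((n + 1 : ℝ)⁻¹ • x) * φ x := rfl

theorem norm_truncate_le (φ : 𝓢(E, ℂ)) (n : ℕ) (x : E) : ‖truncate φ n x‖ ≤ ‖φ x‖ := by
  rw [truncate_apply, norm_mul]
  exact mul_le_of_le_one_left (norm_nonneg _) (norm_cutoffSchwartz_le_one _)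

theorem eventually_truncate_eq (φ : 𝓢(E, ℂ)) (x : E) :
    ∀ᶠ n : ℕ in atTop, truncate φ n x = φ x := by
  filter_upwards [eventually_ge_atTop ⌈‖x‖⌉₊] with n hn
  have h1 : ‖x‖ ≤ n + 1 := (Nat.le_ceil _).trans ((Nat.cast_le.2 hn).trans (by linarith))
  have h2 : cutoff E ((n + 1 : ℝ)⁻¹ • x) = 1 := by
    apply (cutoff E).one_of_mem_closedBall
    rw [mem_closedBall_zero_iff, norm_smul, Real.norm_of_nonneg (by positivity),
      inv_mul_le_iff₀ (by positivity)]
    change ‖x‖ ≤ (n + 1) * 1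
    linarith
  rw [truncate_apply, cutoffSchwartz_apply, h2, Complex.ofReal_one, one_mul]

/-- In the Leibniz formula, each derivative falling on the dilated cutoff gains a factor `(n + 1)⁻¹
≤ 1`, so the bound does not depend on `n`. -/
theorem exists_seminorm_truncate_le (φ : 𝓢(E, ℂ)) (k m : ℕ) :
    ∃ C, ∀ n, SchwartzMap.seminorm ℝ k m (truncate φ n) ≤ C := by
  refine ⟨∑ i ∈ Finset.range (m + 1), (m.choose i : ℝ) *
    SchwartzMap.seminorm ℝ 0 i (cutoffSchwartz E) * SchwartzMap.seminorm ℝ k (m - i) φ,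
    fun n => ?_⟩
  refine SchwartzMap.seminorm_le_bound ℝ k m _ (Finset.sum_nonneg fun i _ => by positivity) ?_
  intro x
  have h1 := norm_iteratedFDeriv_mul_le (N := ∞)
    (((cutoffSchwartz E).smooth ⊤).comp (contDiff_const_smul ((n + 1 : ℝ)⁻¹))) (φ.smooth ⊤) x
    (n := m) (mod_cast le_top)
  have h2 : ‖iteratedFDeriv ℝ m (truncate φ n) x‖ ≤ _ := h1
  refine (mul_le_mul_of_nonneg_left h2 (by positivity)).trans ?_
  rw [Finset.mul_sum]
  refine Finset.sum_le_sum fun i _ => ?_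
  have h3 : ‖iteratedFDeriv ℝ i (⇑(cutoffSchwartz E) ∘ fun x => (n + 1 : ℝ)⁻¹ • x) x‖ ≤
      SchwartzMap.seminorm ℝ 0 i (cutoffSchwartz E) := by
    have h4 := congrFun (iteratedFDeriv_comp_const_smul (i := i) ((n + 1 : ℝ)⁻¹)
      ((cutoffSchwartz E).smooth i)) x
    change ‖iteratedFDeriv ℝ i (fun x => cutoffSchwartz E ((n + 1 : ℝ)⁻¹ • x)) x‖ ≤ _
    rw [h4, norm_smul]
    refine (mul_le_of_le_one_left (norm_nonneg _) ?_).trans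
      ((cutoffSchwartz E).norm_iteratedFDeriv_le_seminorm ℝ i _)
    rw [norm_pow, Real.norm_of_nonneg (by positivity)]
    refine pow_le_one₀ (by positivity) (inv_le_one_of_one_le₀ ?_)
    linarith [n.cast_nonneg (α := ℝ)]
  calc _ = (m.choose i : ℝ) *
        ‖iteratedFDeriv ℝ i (⇑(cutoffSchwartz E) ∘ fun x => (n + 1 : ℝ)⁻¹ • x) x‖ *
        (‖x‖ ^ k * ‖iteratedFDeriv ℝ (m - i) φ x‖) := by ring
    _ ≤ _ := by
      gcongr
      exact φ.le_seminorm ℝ k (m - i) x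

variable [MeasurableSpace E] [BorelSpace E]

/-- The Fourier transform is continuous on Schwartz space, so it maps the bounded set of truncations
to a bounded set. -/
theorem exists_seminorm_fourier_truncate_le (φ : 𝓢(E, ℂ)) (k m : ℕ) :
    ∃ C, ∀ n, SchwartzMap.seminorm ℝ k m (𝓕 (truncate φ n)) ≤ C := by
  have h1 : Bornology.IsVonNBounded ℝ (range (truncate φ)) := by
    rw [(schwartz_withSeminorms ℝ E ℂ).isVonNBounded_iff_seminorm_bddAbove]
    intro i
    obtain ⟨C, hC⟩ := exists_seminorm_truncate_le φ i.1 i.2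
    refine ⟨C, ?_⟩
    rintro _ ⟨_, ⟨n, rfl⟩, rfl⟩
    exact hC n
  have h2 := h1.image ((FourierTransform.fourierCLM ℂ 𝓢(E, ℂ)).restrictScalars ℝ)
  rw [(schwartz_withSeminorms ℝ E ℂ).isVonNBounded_iff_seminorm_bddAbove] at h2
  obtain ⟨C, hC⟩ := h2 (k, m)
  exact ⟨C, fun n => hC ⟨_, ⟨_, ⟨n, rfl⟩, rfl⟩, rfl⟩⟩

theorem exists_norm_fourier_truncate_le (φ : 𝓢(E, ℂ)) (k : ℕ) :
    ∃ C, ∀ n x, ‖𝓕 (truncate φ n) x‖ ≤ C * ((1 + ‖x‖) ^ k)⁻¹ := by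
  obtain ⟨C₀, h0⟩ := exists_seminorm_fourier_truncate_le φ 0 0
  obtain ⟨C₁, h1⟩ := exists_seminorm_fourier_truncate_le φ k 0
  -- The power of two comes from `(1 + ‖x‖) ^ k ≤ 2 ^ (k - 1) * (1 + ‖x‖ ^ k)`, which also holds for
  -- `k = 0` with truncated subtraction.
  refine ⟨2 ^ (k - 1) * (C₀ + C₁), fun n x => ?_⟩
  rw [← div_eq_mul_inv, le_div_iff₀ (by positivity)]
  have e0 := ((𝓕 (truncate φ n)).norm_pow_mul_le_seminorm ℝ 0 x).trans (h0 n)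
  have e1 := ((𝓕 (truncate φ n)).norm_pow_mul_le_seminorm ℝ k x).trans (h1 n)
  have e2 := add_pow_le zero_le_one (norm_nonneg x) k
  calc _ ≤ ‖𝓕 (truncate φ n) x‖ * (2 ^ (k - 1) * (1 ^ k + ‖x‖ ^ k)) := by gcongr
    _ = 2 ^ (k - 1) * (‖x‖ ^ 0 * ‖𝓕 (truncate φ n) x‖ + ‖x‖ ^ k * ‖𝓕 (truncate φ n) x‖) := by
      rw [one_pow, pow_zero]; ring
    _ ≤ _ := by gcongr

theorem tendsto_fourier_truncate (φ : 𝓢(E, ℂ)) (x : E) :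
    Tendsto (fun n => 𝓕 (truncate φ n) x) atTop (𝓝 (𝓕 φ x)) := by
  simp_rw [SchwartzMap.fourier_coe, Real.fourier_eq]
  refine tendsto_integral_of_dominated_convergence (fun v => ‖φ v‖) ?_ φ.integrable.norm ?_ ?_
  · intro n
    exact ((Real.fourierIntegral_convergent_iff x).2 (truncate φ n).integrable).aestronglyMeasurable
  · intro n
    refine Eventually.of_forall fun v => ?_
    rw [Circle.norm_smul]
    exact norm_truncate_le φ n v
  · refine Eventually.of_forall fun v => ?_
    refine tendsto_const_nhds.congr' ?_
    filter_upwards [eventually_truncate_eq φ v] with n hn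
    rw [hn]

end Cutoff

theorem inv_one_add_norm_smul_pow_le {E : Type*} [NormedAddCommGroup E] [NormedSpace ℝ E]
    {s : ℝ} (hs : 0 < s) (d : ℕ) (x : E) :
    ((1 + ‖s • x‖) ^ d)⁻¹ ≤ (1 + s⁻¹) ^ d * ((1 + ‖x‖) ^ d)⁻¹ := by
  rw [← div_eq_mul_inv, le_div_iff₀ (by positivity), inv_mul_le_iff₀ (by positivity), ← mul_pow]
  refine pow_le_pow_left₀ (by positivity) ?_ _
  rw [norm_smul, Real.norm_of_nonneg hs.le]
  have := norm_nonneg x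
  have h : s * s⁻¹ = 1 := mul_inv_cancel₀ hs.ne'
  have : 0 < s⁻¹ := by positivity
  nlinarith [mul_nonneg hs.le (norm_nonneg x)]

/-- On the side of `K`, truncations converge by dominated convergence against the integrable weight.
On the side of `Khat` they are only bounded pointwise by `φ`. Equality is not claimed, since `Khat *
φ` need not be integrable; the right side may be infinite. -/
theorem IsDistributionalFourierTransform.enorm_integral_le {d : ℕ}
    {K Khat : EuclideanSpace ℝ (Fin d) → ℂ} (hK : IsDistributionalFourierTransform K Khat)
    (hKm : AEStronglyMeasurable K volume)
    (hKi : Integrable (fun x => ‖K x‖ * ((1 + ‖x‖) ^ d)⁻¹) volume)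
    (φ : 𝓢(EuclideanSpace ℝ (Fin d), ℂ)) :
    ‖∫ x, K x * testFourier φ x‖ₑ ≤ ∫⁻ ξ, ‖Khat ξ‖ₑ * ‖φ ξ‖ₑ := by
  obtain ⟨C, hC⟩ := exists_norm_fourier_truncate_le φ d
  have hlim : Tendsto (fun n => ∫ x, K x * testFourier (truncate φ n) x) atTop
      (𝓝 (∫ x, K x * testFourier φ x)) := by
    refine tendsto_integral_of_dominated_convergence
      (fun x => C * (1 + (2 * Real.pi)⁻¹⁻¹) ^ d * (‖K x‖ * ((1 + ‖x‖) ^ d)⁻¹)) ?_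
      (hKi.const_mul _) ?_ ?_
    · intro n
      refine hKm.mul (Continuous.aestronglyMeasurable ?_)
      have : testFourier (truncate φ n) = fun x => 𝓕 (truncate φ n) ((2 * Real.pi)⁻¹ • x) := by
        ext x
        rw [testFourier_eq_fourier, SchwartzMap.fourier_coe]
      rw [this]
      exact (𝓕 (truncate φ n)).continuous.comp (continuous_const_smul _)
    · intro n
      refine Eventually.of_forall fun x => ?_
      have hC0 : 0 ≤ C := by
        have := (norm_nonneg _).trans (hC 0 0)
        simpa using this
      rw [norm_mul, testFourier_eq_fourier, ← SchwartzMap.fourier_coe]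
      calc _ ≤ ‖K x‖ * (C * ((1 + (2 * Real.pi)⁻¹⁻¹) ^ d * ((1 + ‖x‖) ^ d)⁻¹)) := by
            gcongr
            refine (hC n _).trans ?_
            gcongr
            exact inv_one_add_norm_smul_pow_le (by positivity) d x
        _ = _ := by ring
    · refine Eventually.of_forall fun x => ?_
      refine Tendsto.const_mul _ ?_
      simp_rw [testFourier_eq_fourier, ← SchwartzMap.fourier_coe]
      exact tendsto_fourier_truncate φ _
  refine le_of_tendsto hlim.enorm (Eventually.of_forall fun n => ?_)
  have h := hK.2 (truncate φ n) (contDiff_truncate φ n) (hasCompactSupport_truncate φ n)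
  rw [h]
  refine (enorm_integral_le_lintegral_enorm _).trans (lintegral_mono fun ξ => ?_)
  rw [enorm_mul]
  gcongr
  exact enorm_le_iff_norm_le.2 (norm_truncate_le φ n ξ)

end FourierBound

/-! ### Homogeneity of the Fourier transform and the power of `λ`. -/

section Scaling

open MeasureTheory Filter Topology Set
open scoped ENNReal ContDiff

theorem locallyIntegrable_comp_const_smul {d : ℕ} {f : EuclideanSpace ℝ (Fin d) → ℂ}
    (hf : LocallyIntegrable f volume) {s : ℝ} (hs : s ≠ 0) :
    LocallyIntegrable (fun x => f (s • x)) volume := by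
  have h := locallyIntegrable_map_homeomorph (μ := volume)
    (Homeomorph.smulOfNeZero (α := EuclideanSpace ℝ (Fin d)) s hs) (f := f)
  refine h.1 ?_
  have h2 : Measure.map (⇑(Homeomorph.smulOfNeZero (α := EuclideanSpace ℝ (Fin d)) s hs)) volume
      = ENNReal.ofReal |(s ^ Module.finrank ℝ (EuclideanSpace ℝ (Fin d)))⁻¹| • volume :=
    Measure.map_addHaar_smul volume hs
  rw [h2]
  intro x
  obtain ⟨U, hU, hfU⟩ := hf x
  refine ⟨U, hU, ?_⟩
  rw [IntegrableOn, Measure.restrict_smul]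
  exact hfU.smul_measure ENNReal.ofReal_ne_top

theorem testFourier_comp_inv_smul {d : ℕ} (φ : EuclideanSpace ℝ (Fin d) → ℂ) {s : ℝ} (hs : 0 < s)
    (x : EuclideanSpace ℝ (Fin d)) :
    testFourier (fun ξ => φ (s⁻¹ • ξ)) x = ((s ^ d : ℝ) : ℂ) * testFourier φ (s • x) := by
  have h := Measure.integral_comp_smul_of_nonneg volume
    (fun y => Complex.exp (-Complex.I * ((inner ℝ y x : ℝ) : ℂ)) * φ (s⁻¹ • y)) s (hR := hs.le)
  rw [finrank_euclideanSpace_fin, eq_inv_smul_iff₀ (by positivity)] at h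
  rw [testFourier, ← h, testFourier, Complex.real_smul]
  congr 2
  ext y
  rw [inv_smul_smul₀ hs.ne', inner_smul_left, inner_smul_right]
  simp

/-- Both sides are tested against real smooth functions, moving the dilation onto `K`. The
exceptional null set may depend on `s`, which is harmless as a single `s` is used later. -/
theorem IsDistributionalFourierTransform.ae_eq_comp_smul {d : ℕ} (hd : 1 ≤ d) {α : ℝ}
    {K Khat : EuclideanSpace ℝ (Fin d) → ℂ} (hK : IsDistributionalFourierTransform K Khat)
    (hKhom : IsHomogeneousOfOrder (α - d) K) {s : ℝ} (hs : 0 < s) :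
    ∀ᵐ ξ, Khat (s • ξ) = ((s ^ (-α) : ℝ) : ℂ) * Khat ξ := by
  refine ae_eq_of_integral_contDiff_smul_eq (locallyIntegrable_comp_const_smul hK.1 hs.ne')
    (hK.1.smul ((s ^ (-α) : ℝ) : ℂ)) ?_
  intro g hg hgs
  set φ : EuclideanSpace ℝ (Fin d) → ℂ := fun ξ => ((g ξ : ℝ) : ℂ) with hφ
  have hφ1 : ContDiff ℝ ∞ φ := Complex.ofRealCLM.contDiff.comp hg
  have hφ2 : HasCompactSupport φ := hgs.comp_left Complex.ofReal_zero
  have h1 := hK.2 φ hφ1 hφ2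
  have h2 := hK.2 (fun ξ => φ (s⁻¹ • ξ)) (hφ1.comp (contDiff_const_smul _))
    (hφ2.comp_smul (inv_ne_zero hs.ne'))
  have h3 := Measure.integral_comp_smul_of_nonneg volume
    (fun ξ => Khat ξ * φ (s⁻¹ • ξ)) s (hR := hs.le)
  have h4 := Measure.integral_comp_smul_of_nonneg volume
    (fun x => K (s⁻¹ • x) * testFourier φ x) s (hR := hs.le)
  rw [finrank_euclideanSpace_fin, Complex.real_smul] at h3 h4
  simp only [inv_smul_smul₀ hs.ne'] at h3 h4
  have h5 : ∫ x, K (s⁻¹ • x) * testFourier φ x =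
      ((s⁻¹ ^ (α - d) : ℝ) : ℂ) * ∫ x, K x * testFourier φ x := by
    rw [← integral_const_mul]
    refine integral_congr_ae ?_
    filter_upwards [ae_ne_zero_of_pos_dim hd] with x hx
    rw [hKhom _ (inv_pos.2 hs) x hx, mul_assoc]
  simp_rw [testFourier_comp_inv_smul φ hs] at h2
  have h6 : ∫ x, K x * (((s ^ d : ℝ) : ℂ) * testFourier φ (s • x)) =
      ((s ^ d : ℝ) : ℂ) * ∫ x, K x * testFourier φ (s • x) := by
    rw [← integral_const_mul]
    congr 1 with x
    ring
  rw [h6] at h2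
  have h7 : ∫ x, g x • Khat (s • x) = ∫ x, Khat (s • x) * φ x := by
    congr 1 with x
    rw [Complex.real_smul, mul_comm]
  have h8 : ∫ x, g x • (((s ^ (-α) : ℝ) : ℂ) * Khat x) =
      ((s ^ (-α) : ℝ) : ℂ) * ∫ x, Khat x * φ x := by
    rw [← integral_const_mul]
    congr 1 with x
    rw [Complex.real_smul]
    ring
  rw [h7, h8, h3, ← h2, ← mul_assoc, h4, h5, h1, ← mul_assoc, ← mul_assoc]
  congr 1
  have h9 : (s ^ d)⁻¹ * s ^ d * (s ^ d)⁻¹ * s⁻¹ ^ (α - d) = s ^ (-α) := by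
    rw [inv_mul_cancel₀ (by positivity), one_mul, Real.inv_rpow hs.le, ← Real.rpow_neg hs.le,
      ← Real.rpow_natCast, ← Real.rpow_neg hs.le, ← Real.rpow_add hs]
    ring_nf
  exact_mod_cast h9

theorem IsDistributionalFourierTransform.lintegral_norm_sub {d : ℕ} (hd : 1 ≤ d) {α : ℝ}
    (hα : 0 < α) {K Khat : EuclideanSpace ℝ (Fin d) → ℂ}
    (hK : IsDistributionalFourierTransform K Khat)
    (hKhom : IsHomogeneousOfOrder (α - d) K) {lam : ℝ} (hlam : 0 < lam) :
    ∫⁻ ξ, ENNReal.ofReal (‖Khat ξ‖ - lam) =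
      ENNReal.ofReal (lam ^ (1 - d / α)) * ∫⁻ ξ, ENNReal.ofReal (‖Khat ξ‖ - 1) := by
  -- This dilation makes `‖Khat (s • ξ)‖ = lam * ‖Khat ξ‖`; the Jacobian then gives `s ^ d * lam =
  -- lam ^ (1 - d / α)`.
  set s : ℝ := lam ^ (-(1 / α)) with hs
  have hs0 : 0 < s := by positivity
  have hsα : s ^ (-α) = lam := by
    rw [hs, ← Real.rpow_mul hlam.le]
    have : -(1 / α) * -α = 1 := by field_simp
    rw [this, Real.rpow_one]
  have h1 := lintegral_comp_smul_eq (volume : Measure (EuclideanSpace ℝ (Fin d)))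
    (fun ξ => ENNReal.ofReal (‖Khat ξ‖ - lam)) hs0
  have h2 : ∫⁻ ξ, ENNReal.ofReal (‖Khat (s • ξ)‖ - lam) =
      ENNReal.ofReal lam * ∫⁻ ξ, ENNReal.ofReal (‖Khat ξ‖ - 1) := by
    rw [← lintegral_const_mul' _ _ ENNReal.ofReal_ne_top]
    refine lintegral_congr_ae ?_
    filter_upwards [hK.ae_eq_comp_smul hd hKhom hs0] with ξ hξ
    rw [hξ, norm_mul, Complex.norm_real, Real.norm_of_nonneg (by positivity), hsα,
      ← ENNReal.ofReal_mul hlam.le]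
    ring_nf
  rw [h2, finrank_euclideanSpace_fin] at h1
  have h3 : ENNReal.ofReal (s ^ d) * ENNReal.ofReal ((s ^ d)⁻¹) = 1 := by
    rw [← ENNReal.ofReal_mul (by positivity), mul_inv_cancel₀ (by positivity), ENNReal.ofReal_one]
  calc _ = ENNReal.ofReal (s ^ d) * (ENNReal.ofReal ((s ^ d)⁻¹) *
        ∫⁻ ξ, ENNReal.ofReal (‖Khat ξ‖ - lam)) := by rw [← mul_assoc, h3, one_mul]
    _ = _ := by
      rw [← h1, ← mul_assoc, ← ENNReal.ofReal_mul (by positivity)]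
      congr 2
      rw [hs, ← Real.rpow_natCast, ← Real.rpow_mul hlam.le]
      nth_rewrite 2 [← Real.rpow_one lam]
      rw [← Real.rpow_add hlam]
      ring_nf

end Scaling

/-! ### Test functions in `L²(Ω)` and self-adjointness. -/

section TestFunctions

open MeasureTheory Filter Topology Set
open scoped ENNReal ContDiff SchwartzMap FourierTransform ComplexConjugate InnerProductSpace

/-- `φ` is a test function on `Ω`. -/
structure IsTestFunction {d : ℕ} (Ω : Set (EuclideanSpace ℝ (Fin d)))
    (φ : EuclideanSpace ℝ (Fin d) → ℂ) : Prop where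
  contDiff : ContDiff ℝ ∞ φ
  hasCompactSupport : HasCompactSupport φ
  tsupport_subset : tsupport φ ⊆ Ω

namespace IsTestFunction

variable {d : ℕ} {Ω : Set (EuclideanSpace ℝ (Fin d))} {φ ψ : EuclideanSpace ℝ (Fin d) → ℂ}

theorem continuous (hφ : IsTestFunction Ω φ) : Continuous φ := hφ.contDiff.continuous

theorem integrable (hφ : IsTestFunction Ω φ) : Integrable φ volume :=
  hφ.continuous.integrable_of_hasCompactSupport hφ.hasCompactSupport

theorem memLp (hφ : IsTestFunction Ω φ) : MemLp φ 2 (volume.restrict Ω) :=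
  (hφ.continuous.memLp_of_hasCompactSupport hφ.hasCompactSupport).restrict Ω

theorem eq_zero_of_notMem (hφ : IsTestFunction Ω φ) {x : EuclideanSpace ℝ (Fin d)} (hx : x ∉ Ω) :
    φ x = 0 :=
  image_eq_zero_of_notMem_tsupport fun h => hx (hφ.tsupport_subset h)

theorem add (hφ : IsTestFunction Ω φ) (hψ : IsTestFunction Ω ψ) : IsTestFunction Ω (φ + ψ) where
  contDiff := hφ.contDiff.add hψ.contDiff
  hasCompactSupport := hφ.hasCompactSupport.add hψ.hasCompactSupport
  tsupport_subset := (tsupport_add φ ψ).trans (union_subset hφ.tsupport_subset hψ.tsupport_subset)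

theorem zero : IsTestFunction Ω 0 where
  contDiff := contDiff_const
  hasCompactSupport := HasCompactSupport.zero
  tsupport_subset := by simp [tsupport]

theorem smul (c : ℂ) (hφ : IsTestFunction Ω φ) : IsTestFunction Ω (c • φ) where
  contDiff := contDiff_const.smul hφ.contDiff
  hasCompactSupport := hφ.hasCompactSupport.smul_left (f := fun _ => c)
  tsupport_subset := (closure_mono (Function.support_const_smul_subset c φ)).trans
    hφ.tsupport_subset

/-- A test function as a Schwartz function. -/
noncomputable def toSchwartz (hφ : IsTestFunction Ω φ) : 𝓢(EuclideanSpace ℝ (Fin d), ℂ) :=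
  hφ.hasCompactSupport.toSchwartzMap hφ.contDiff

end IsTestFunction

variable {d : ℕ} {Ω : Set (EuclideanSpace ℝ (Fin d))}

/-- The subspace of `L²(Ω)` of the classes of the test functions. -/
def testSubmodule (Ω : Set (EuclideanSpace ℝ (Fin d))) : Submodule ℂ (L2 Ω) where
  carrier := {u | ∃ φ, IsTestFunction Ω φ ∧ u =ᵐ[volume.restrict Ω] φ}
  add_mem' := by
    rintro u v ⟨φ, hφ, hu⟩ ⟨ψ, hψ, hv⟩
    exact ⟨φ + ψ, hφ.add hψ, (Lp.coeFn_add u v).trans (hu.add hv)⟩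
  zero_mem' := ⟨0, IsTestFunction.zero, Lp.coeFn_zero _ _ _⟩
  smul_mem' := by
    rintro c u ⟨φ, hφ, hu⟩
    exact ⟨c • φ, hφ.smul c, (Lp.coeFn_smul c u).trans (hu.const_smul c)⟩

/-- A vector orthogonal to all test functions vanishes by the fundamental lemma of the calculus of
variations. -/
theorem dense_testSubmodule (hΩ : IsOpen Ω) : Dense (testSubmodule Ω : Set (L2 Ω)) := by
  rw [Submodule.dense_iff_topologicalClosure_eq_top, Submodule.topologicalClosure_eq_top_iff,
    Submodule.eq_bot_iff]
  intro v hv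
  rw [Submodule.mem_orthogonal] at hv
  have hvloc : LocallyIntegrableOn v Ω volume := by
    have h := (Lp.memLp v).locallyIntegrable (by norm_num)
    exact locallyIntegrableOn_of_locallyIntegrable_restrict h
  have h0 : ∀ᵐ x ∂volume, x ∈ Ω → v x = 0 := by
    refine hΩ.ae_eq_zero_of_integral_contDiff_smul_eq_zero hvloc fun g hg hgc hgΩ => ?_
    have hφ : IsTestFunction Ω fun x => ((g x : ℝ) : ℂ) :=
      ⟨Complex.ofRealCLM.contDiff.comp hg, hgc.comp_left Complex.ofReal_zero,
        (closure_mono (Function.support_comp_subset Complex.ofReal_zero g)).trans hgΩ⟩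
    have h1 := hv (hφ.memLp.toLp _) ⟨_, hφ, hφ.memLp.coeFn_toLp⟩
    rw [L2.inner_def] at h1
    rw [← h1, ← setIntegral_eq_integral_of_forall_compl_eq_zero (s := Ω)]
    · refine integral_congr_ae ?_
      filter_upwards [hφ.memLp.coeFn_toLp] with x hx
      rw [hx, RCLike.inner_apply, Complex.conj_ofReal, Complex.real_smul, mul_comm]
    · intro x hx
      have := hφ.eq_zero_of_notMem hx
      rw [Complex.ofReal_eq_zero] at this
      rw [this, zero_smul]
  rw [Lp.eq_zero_iff_ae_eq_zero]
  exact (ae_restrict_iff' hΩ.measurableSet).2 h0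

/-- The integrand vanishes unless the first variable lies in the compact set `tsupport ψ - tsupport
φ`, where `K` is integrable. It justifies every use of Fubini below. -/
theorem integrable_kernel_mul_shift {K φ ψ : EuclideanSpace ℝ (Fin d) → ℂ}
    (hK : LocallyIntegrable K volume) (hφ : IsTestFunction Ω φ) (hψ : IsTestFunction Ω ψ) :
    Integrable (fun p : EuclideanSpace ℝ (Fin d) × EuclideanSpace ℝ (Fin d) =>
      K p.1 * (φ p.2 * conj (ψ (p.1 + p.2)))) (volume.prod volume) := by
  obtain ⟨C, hC⟩ := hψ.continuous.bounded_above_of_compact_support hψ.hasCompactSupport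
  have hS : IsCompact ((fun p : EuclideanSpace ℝ (Fin d) × EuclideanSpace ℝ (Fin d) => p.1 - p.2) ''
      (tsupport ψ ×ˢ tsupport φ)) :=
    (IsCompact.prod hψ.hasCompactSupport hφ.hasCompactSupport).image continuous_sub
  set S := (fun p : EuclideanSpace ℝ (Fin d) × EuclideanSpace ℝ (Fin d) => p.1 - p.2) ''
    (tsupport ψ ×ˢ tsupport φ)
  have h1 : Integrable (S.indicator fun z => ‖K z‖) volume :=
    IntegrableOn.integrable_indicator (hK.integrableOn_isCompact hS).norm hS.measurableSet
  have h2 := (h1.mul_prod (hφ.integrable.norm.mul_const C))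
  refine h2.mono' ?_ (Eventually.of_forall fun p => ?_)
  · refine hK.aestronglyMeasurable.comp_fst.mul (Continuous.aestronglyMeasurable ?_)
    have := hφ.continuous
    have := hψ.continuous
    fun_prop
  · have hC0 : 0 ≤ C := (norm_nonneg _).trans (hC 0)
    by_cases hp : p.1 ∈ S
    · rw [indicator_of_mem hp, norm_mul, norm_mul, RCLike.norm_conj]
      gcongr
      exact hC _
    · have : φ p.2 * conj (ψ (p.1 + p.2)) = 0 := by
        by_contra hne
        obtain ⟨h3, h4⟩ := mul_ne_zero_iff.1 hne
        exact hp ⟨(p.1 + p.2, p.2), ⟨subset_tsupport _ fun h => h4 (by rw [h, map_zero]),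
          subset_tsupport _ h3⟩, by simp⟩
      rw [this, mul_zero, norm_zero, indicator_of_notMem hp, zero_mul]

theorem integrable_kernel_sub {K φ ψ : EuclideanSpace ℝ (Fin d) → ℂ}
    (hK : LocallyIntegrable K volume) (hφ : IsTestFunction Ω φ) (hψ : IsTestFunction Ω ψ) :
    Integrable (fun p : EuclideanSpace ℝ (Fin d) × EuclideanSpace ℝ (Fin d) =>
      K (p.1 - p.2) * (φ p.2 * conj (ψ p.1))) (volume.prod volume) := by
  have h := (measurePreserving_sub_prod (volume : Measure (EuclideanSpace ℝ (Fin d)))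
    (volume : Measure (EuclideanSpace ℝ (Fin d)))).integrable_comp_of_integrable
    (integrable_kernel_mul_shift hK hφ hψ)
  simpa [Function.comp_def] using h

theorem IsConvolutionOperator.inner_apply_test {K φ ψ : EuclideanSpace ℝ (Fin d) → ℂ}
    {T : L2 Ω →L[ℂ] L2 Ω} (hT : IsConvolutionOperator Ω K T)
    (hφ : IsTestFunction Ω φ) (hψ : IsTestFunction Ω ψ) {u v : L2 Ω}
    (hu : u =ᵐ[volume.restrict Ω] φ) (hv : v =ᵐ[volume.restrict Ω] ψ) :
    ⟪v, T u⟫_ℂ = ∫ x, ∫ y, K (x - y) * (φ y * conj (ψ x)) := by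
  rw [L2.inner_def]
  have h1 : ∀ᵐ x ∂(volume.restrict Ω), ⟪v x, T u x⟫_ℂ =
      ∫ y, K (x - y) * (φ y * conj (ψ x)) := by
    filter_upwards [hT u, hv] with x hx hvx
    rw [hx.2, hvx, RCLike.inner_apply, ← integral_mul_const]
    refine Eq.trans ?_ (setIntegral_eq_integral_of_forall_compl_eq_zero (s := Ω)
      (f := fun y => K (x - y) * (φ y * conj (ψ x))) fun y hy => ?_)
    · refine integral_congr_ae ?_
      filter_upwards [hu] with y hy
      rw [hy]
      ring
    · rw [hφ.eq_zero_of_notMem hy]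
      ring
  rw [integral_congr_ae h1, setIntegral_eq_integral_of_forall_compl_eq_zero]
  intro x hx
  simp [hψ.eq_zero_of_notMem hx]

/-- On test functions symmetry is Fubini together with the Hermitian symmetry of `K`; boundedness of
`T` and density extend it, one variable at a time. -/
theorem IsConvolutionOperator.isSelfAdjoint (hd : 1 ≤ d) {K : EuclideanSpace ℝ (Fin d) → ℂ}
    {T : L2 Ω →L[ℂ] L2 Ω} (hΩ : IsOpen Ω) (hK : LocallyIntegrable K volume)
    (hKsymm : ∀ x, x ≠ 0 → K x = conj (K (-x))) (hT : IsConvolutionOperator Ω K T) :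
    IsSelfAdjoint T := by
  rw [ContinuousLinearMap.isSelfAdjoint_iff_isSymmetric]
  have key : ∀ u ∈ testSubmodule Ω, ∀ v ∈ testSubmodule Ω, ⟪T u, v⟫_ℂ = ⟪u, T v⟫_ℂ := by
    rintro u ⟨φ, hφ, hu⟩ v ⟨ψ, hψ, hv⟩
    rw [← inner_conj_symm, hT.inner_apply_test hφ hψ hu hv,
      hT.inner_apply_test hψ hφ hv hu, ← integral_conj]
    have h1 : ∀ x, conj (∫ y, K (x - y) * (φ y * conj (ψ x))) =
        ∫ y, K (y - x) * (ψ x * conj (φ y)) := by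
      intro x
      rw [← integral_conj]
      refine integral_congr_ae ?_
      -- The symmetry of `K` is not assumed at the origin, so the diagonal is discarded; points are
      -- null because `d ≥ 1`.
      have hne : ∀ᵐ y : EuclideanSpace ℝ (Fin d), y ≠ x := by
        have : Nonempty (Fin d) := ⟨⟨0, hd⟩⟩
        exact compl_mem_ae_iff.2 (measure_singleton x)
      filter_upwards [hne] with y hy
      rw [hKsymm (y - x) (sub_ne_zero.2 hy), neg_sub, map_mul, map_mul, RCLike.conj_conj]
      ring
    simp_rw [h1]
    exact integral_integral_swap (f := fun x y => K (y - x) * (ψ x * conj (φ y)))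
      (integrable_kernel_sub hK hψ hφ).swap
  have hdense := dense_testSubmodule hΩ
  intro u v
  have h1 : ∀ u ∈ testSubmodule Ω, ∀ v, ⟪T u, v⟫_ℂ = ⟪u, T v⟫_ℂ := fun u hu v =>
    congrFun (Continuous.ext_on hdense (f := fun v => ⟪T u, v⟫_ℂ) (g := fun v => ⟪u, T v⟫_ℂ)
      (by fun_prop) (by fun_prop) fun v hv => key u hu v hv) v
  exact congrFun (Continuous.ext_on hdense (f := fun u => ⟪T u, v⟫_ℂ) (g := fun u => ⟪u, T v⟫_ℂ)
      (by fun_prop) (by fun_prop) fun u hu => h1 u hu v) u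

end TestFunctions

/-! ### The quadratic form on the Fourier side. -/

section Spectral

open MeasureTheory Filter Topology Set
open scoped ENNReal ContDiff SchwartzMap FourierTransform ComplexConjugate InnerProductSpace

section Autocorrelation

variable {E : Type*} [NormedAddCommGroup E] [InnerProductSpace ℝ E]

/-- The squared modulus of a Schwartz function. -/
noncomputable def normSqSchwartz (φ : 𝓢(E, ℂ)) : 𝓢(E, ℂ) :=
  SchwartzMap.pairing (ContinuousLinearMap.mul ℝ ℂ)
    (SchwartzMap.postcompCLM (𝕜 := ℝ) (Complex.conjCLE : ℂ →L[ℝ] ℂ) φ) φ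

theorem normSqSchwartz_apply (φ : 𝓢(E, ℂ)) (x : E) : normSqSchwartz φ x = conj (φ x) * φ x := by
  simp [normSqSchwartz, SchwartzMap.pairing_apply_apply]

theorem norm_normSqSchwartz (φ : 𝓢(E, ℂ)) (x : E) : ‖normSqSchwartz φ x‖ = ‖φ x‖ ^ 2 := by
  rw [normSqSchwartz_apply, norm_mul, RCLike.norm_conj, sq]

variable [FiniteDimensional ℝ E] [MeasurableSpace E] [BorelSpace E]

theorem fourier_compSubConst_neg (φ : 𝓢(E, ℂ)) (z η : E) :
    𝓕 (SchwartzMap.compSubConstCLM ℝ (-z) φ) η = Real.fourierChar (inner ℝ z η) • 𝓕 φ η := by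
  have h := congrFun (VectorFourier.fourierIntegral_comp_add_right Real.fourierChar volume
    (innerₗ E) φ z) η
  rw [SchwartzMap.fourier_coe, SchwartzMap.fourier_coe]
  have h2 : ⇑(SchwartzMap.compSubConstCLM ℝ (-z) φ) = φ ∘ fun v => v + z := by
    ext v
    simp [SchwartzMap.compSubConstCLM_apply]
  rw [h2]
  exact h

/-- Parseval applied to `φ` and its translate, which differ on the Fourier side by a character. -/
theorem integral_mul_conj_shift_eq_fourier (φ : 𝓢(E, ℂ)) (z : E) :
    ∫ y, φ y * conj (φ (z + y)) = 𝓕 (normSqSchwartz (𝓕 φ)) z := by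
  have h1 := SchwartzMap.integral_inner_fourier_fourier (SchwartzMap.compSubConstCLM ℝ (-z) φ) φ
  have h2 : ∫ y, ⟪SchwartzMap.compSubConstCLM ℝ (-z) φ y, φ y⟫_ℂ =
      ∫ y, φ y * conj (φ (z + y)) := by
    congr 1 with y
    rw [SchwartzMap.compSubConstCLM_apply, RCLike.inner_apply, sub_neg_eq_add, add_comm]
  have h3 : 𝓕 (normSqSchwartz (𝓕 φ)) z = 𝓕 (⇑(normSqSchwartz (𝓕 φ))) z := by
    rw [SchwartzMap.fourier_coe]
  rw [← h2, ← h1, h3, Real.fourier_eq]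
  congr 1 with η
  rw [fourier_compSubConst_neg, normSqSchwartz_apply, RCLike.inner_apply, Circle.smul_def,
    Circle.smul_def, smul_eq_mul, smul_eq_mul, map_mul, ← Circle.coe_inv_eq_conj,
    ← AddChar.map_neg_eq_inv, real_inner_comm]
  ring

end Autocorrelation

variable {d : ℕ} {Ω : Set (EuclideanSpace ℝ (Fin d))}

/-- The function `(2π)^{-d} |φ̂|²`, where `φ̂ = testFourier φ`, as a Schwartz function. -/
noncomputable def spectralDensity (φ : 𝓢(EuclideanSpace ℝ (Fin d), ℂ)) :
    𝓢(EuclideanSpace ℝ (Fin d), ℂ) :=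
  (((2 * Real.pi) ^ d)⁻¹ : ℝ) • SchwartzMap.compCLMOfContinuousLinearEquiv ℝ
    (ContinuousLinearEquiv.smulLeft (Units.mk0 ((2 * Real.pi)⁻¹ : ℝ) (by positivity)))
    (normSqSchwartz (𝓕 φ))

theorem spectralDensity_apply (φ : 𝓢(EuclideanSpace ℝ (Fin d), ℂ))
    (ξ : EuclideanSpace ℝ (Fin d)) :
    spectralDensity φ ξ = (((2 * Real.pi) ^ d)⁻¹ : ℝ) • normSqSchwartz (𝓕 φ) ((2 * Real.pi)⁻¹ • ξ) :=
  rfl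

theorem enorm_spectralDensity (φ : 𝓢(EuclideanSpace ℝ (Fin d), ℂ))
    (ξ : EuclideanSpace ℝ (Fin d)) :
    ‖spectralDensity φ ξ‖ₑ = ENNReal.ofReal (((2 * Real.pi) ^ d)⁻¹) * ‖testFourier φ ξ‖ₑ ^ 2 := by
  rw [spectralDensity_apply, enorm_smul, Real.enorm_of_nonneg (by positivity),
    testFourier_eq_fourier, ← SchwartzMap.fourier_coe, ← ofReal_norm, norm_normSqSchwartz,
    ENNReal.ofReal_pow (norm_nonneg _), ofReal_norm]

theorem testFourier_spectralDensity (φ : 𝓢(EuclideanSpace ℝ (Fin d), ℂ))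
    (z : EuclideanSpace ℝ (Fin d)) :
    testFourier (spectralDensity φ) z = ∫ y, φ y * conj (φ (z + y)) := by
  have h := testFourier_comp_inv_smul (normSqSchwartz (𝓕 φ)) Real.two_pi_pos z
  rw [testFourier_eq_fourier (normSqSchwartz (𝓕 φ)), inv_smul_smul₀ Real.two_pi_pos.ne',
    ← SchwartzMap.fourier_coe] at h
  rw [integral_mul_conj_shift_eq_fourier]
  have h2 : testFourier (spectralDensity φ) z = ((((2 * Real.pi) ^ d)⁻¹ : ℝ) : ℂ) *
      testFourier (fun ξ => normSqSchwartz (𝓕 φ) ((2 * Real.pi)⁻¹ • ξ)) z := by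
    rw [testFourier, testFourier, ← integral_const_mul]
    congr 1 with x
    rw [spectralDensity_apply, Complex.real_smul]
    ring
  rw [h2, h, ← mul_assoc, ← Complex.ofReal_mul, inv_mul_cancel₀ (by positivity),
    Complex.ofReal_one, one_mul]

theorem lintegral_enorm_testFourier_sq (φ : 𝓢(EuclideanSpace ℝ (Fin d), ℂ)) :
    ENNReal.ofReal (((2 * Real.pi) ^ d)⁻¹) * ∫⁻ ξ, ‖testFourier φ ξ‖ₑ ^ 2 =
      ∫⁻ x, ‖φ x‖ₑ ^ 2 := by
  have h : ∀ ψ : 𝓢(EuclideanSpace ℝ (Fin d), ℂ),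
      ∫⁻ x, ‖ψ x‖ₑ ^ 2 = ENNReal.ofReal (∫ x, ‖ψ x‖ ^ 2) := by
    intro ψ
    rw [ofReal_integral_eq_lintegral_ofReal ((ψ.memLp 2 volume).integrable_norm_pow (by norm_num))
      (Eventually.of_forall fun x => by positivity)]
    simp_rw [ENNReal.ofReal_pow (norm_nonneg _), ofReal_norm]
  rw [h, ← SchwartzMap.integral_norm_sq_fourier, ← h]
  simp_rw [testFourier_eq_fourier, ← SchwartzMap.fourier_coe]
  rw [lintegral_comp_smul_eq volume (fun ξ => ‖𝓕 φ ξ‖ₑ ^ 2) (t := (2 * Real.pi)⁻¹) (by positivity),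
    finrank_euclideanSpace_fin, ← mul_assoc, ← ENNReal.ofReal_mul (by positivity), ← mul_inv,
    ← mul_pow, mul_inv_cancel₀ (by positivity), one_pow, inv_one, ENNReal.ofReal_one, one_mul]

/-- The substitution `z = x - y` turns the form into the pairing of `K` with the autocorrelation of
`φ`, which is the Fourier transform of `(2π)^{-d} |φ̂|²`. -/
theorem IsConvolutionOperator.enorm_inner_test_le {K Khat φ : EuclideanSpace ℝ (Fin d) → ℂ}
    {T : L2 Ω →L[ℂ] L2 Ω} (hT : IsConvolutionOperator Ω K T)
    (hKloc : LocallyIntegrable K volume)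
    (hKi : Integrable (fun x => ‖K x‖ * ((1 + ‖x‖) ^ d)⁻¹) volume)
    (hK : IsDistributionalFourierTransform K Khat)
    (hφ : IsTestFunction Ω φ) {u : L2 Ω} (hu : u =ᵐ[volume.restrict Ω] φ) :
    ‖⟪u, T u⟫_ℂ‖ₑ ≤ ENNReal.ofReal (((2 * Real.pi) ^ d)⁻¹) *
      ∫⁻ ξ, ‖Khat ξ‖ₑ * ‖testFourier φ ξ‖ₑ ^ 2 := by
  have h1 : ⟪u, T u⟫_ℂ = ∫ z, K z * testFourier (spectralDensity hφ.toSchwartz) z := by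
    rw [hT.inner_apply_test hφ hφ hu hu,
      ← integral_prod _ (integrable_kernel_sub hKloc hφ hφ)]
    have hF := integrable_kernel_mul_shift hKloc hφ hφ
    have hmp := measurePreserving_sub_prod (volume : Measure (EuclideanSpace ℝ (Fin d)))
      (volume : Measure (EuclideanSpace ℝ (Fin d)))
    have h2 := integral_map (μ := volume.prod volume) hmp.measurable.aemeasurable
      (by rw [hmp.map_eq]; exact hF.aestronglyMeasurable)
    rw [hmp.map_eq, integral_prod _ hF] at h2
    simp only [sub_add_cancel] at h2
    rw [← h2]
    congr 1 with z
    rw [testFourier_spectralDensity, integral_const_mul]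
    rfl
  rw [h1]
  refine (hK.enorm_integral_le hKloc.aestronglyMeasurable hKi _).trans_eq ?_
  rw [← lintegral_const_mul' _ _ ENNReal.ofReal_ne_top]
  congr 1 with ξ
  rw [enorm_spectralDensity]
  exact mul_left_comm _ _ _

end Spectral

/-! ### Plane waves, continuity by density, and Bessel's inequality. -/

section QuadraticForm

open MeasureTheory Filter Topology Set
open scoped ENNReal ContDiff SchwartzMap FourierTransform ComplexConjugate InnerProductSpace

variable {d : ℕ} {Ω : Set (EuclideanSpace ℝ (Fin d))}

theorem memLp_planeWave [IsFiniteMeasure (volume.restrict Ω)] (ξ : EuclideanSpace ℝ (Fin d)) :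
    MemLp (fun y => Complex.exp (Complex.I * ((inner ℝ y ξ : ℝ) : ℂ))) 2 (volume.restrict Ω) := by
  refine MemLp.of_bound (Continuous.aestronglyMeasurable (by fun_prop)) 1
    (Eventually.of_forall fun y => ?_)
  rw [mul_comm, Complex.norm_exp_ofReal_mul_I]

/-- The function `exp(i y·ξ)` as an element of `L²(Ω)`. -/
noncomputable def planeWave (Ω : Set (EuclideanSpace ℝ (Fin d)))
    [IsFiniteMeasure (volume.restrict Ω)] (ξ : EuclideanSpace ℝ (Fin d)) : L2 Ω :=
  (memLp_planeWave ξ).toLp _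

theorem conj_planeWave_exp (r : ℝ) :
    conj (Complex.exp (Complex.I * (r : ℂ))) = Complex.exp (-Complex.I * (r : ℂ)) := by
  rw [← Complex.exp_conj, map_mul, Complex.conj_I, Complex.conj_ofReal]

theorem inner_planeWave [IsFiniteMeasure (volume.restrict Ω)] (ξ : EuclideanSpace ℝ (Fin d))
    (u : L2 Ω) : ⟪planeWave Ω ξ, u⟫_ℂ =
      ∫ y in Ω, Complex.exp (-Complex.I * ((inner ℝ y ξ : ℝ) : ℂ)) * u y := by
  rw [L2.inner_def]
  refine integral_congr_ae ?_
  filter_upwards [(memLp_planeWave (Ω := Ω) ξ).coeFn_toLp] with y hy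
  rw [planeWave, hy, RCLike.inner_apply, conj_planeWave_exp, mul_comm]

theorem inner_planeWave_test [IsFiniteMeasure (volume.restrict Ω)]
    {φ : EuclideanSpace ℝ (Fin d) → ℂ} (hφ : IsTestFunction Ω φ) {u : L2 Ω}
    (hu : u =ᵐ[volume.restrict Ω] φ) (ξ : EuclideanSpace ℝ (Fin d)) :
    ⟪planeWave Ω ξ, u⟫_ℂ = testFourier φ ξ := by
  rw [inner_planeWave, testFourier]
  refine Eq.trans ?_ (setIntegral_eq_integral_of_forall_compl_eq_zero (s := Ω)
    (f := fun y => Complex.exp (-Complex.I * ((inner ℝ y ξ : ℝ) : ℂ)) * φ y) fun y hy => ?_)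
  · refine integral_congr_ae ?_
    filter_upwards [hu] with y hy
    rw [hy]
  · rw [hφ.eq_zero_of_notMem hy, mul_zero]

theorem enorm_planeWave_sq [IsFiniteMeasure (volume.restrict Ω)] (ξ : EuclideanSpace ℝ (Fin d)) :
    ‖planeWave Ω ξ‖ₑ ^ 2 = volume Ω := by
  have h : ⟪planeWave Ω ξ, planeWave Ω ξ⟫_ℂ = ((volume.restrict Ω).real univ : ℂ) := by
    rw [inner_planeWave]
    have : ∀ᵐ y ∂(volume.restrict Ω),
        Complex.exp (-Complex.I * ((inner ℝ y ξ : ℝ) : ℂ)) * planeWave Ω ξ y = 1 := by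
      filter_upwards [(memLp_planeWave (Ω := Ω) ξ).coeFn_toLp] with y hy
      rw [planeWave, hy, ← Complex.exp_add, neg_mul, neg_add_cancel, Complex.exp_zero]
    rw [integral_congr_ae this]
    simp
  rw [inner_self_eq_norm_sq_to_K] at h
  have h2 : ‖planeWave Ω ξ‖ ^ 2 = (volume.restrict Ω).real univ :=
    Complex.ofReal_injective (by rw [Complex.ofReal_pow]; exact h)
  rw [← ofReal_norm, ← ENNReal.ofReal_pow (norm_nonneg _), h2, ofReal_measureReal,
    Measure.restrict_apply_univ]

theorem continuous_inner_planeWave [IsFiniteMeasure (volume.restrict Ω)] (u : L2 Ω) :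
    Continuous fun ξ => ⟪planeWave Ω ξ, u⟫_ℂ := by
  simp_rw [inner_planeWave]
  have hu : Integrable u (volume.restrict Ω) := (Lp.memLp u).integrable (by norm_num)
  refine continuous_of_dominated (bound := fun y => ‖u y‖) ?_ ?_ hu.norm ?_
  · intro ξ
    exact (Continuous.aestronglyMeasurable (by fun_prop)).mul hu.aestronglyMeasurable
  · intro ξ
    refine Eventually.of_forall fun y => ?_
    rw [norm_mul, ← conj_planeWave_exp, RCLike.norm_conj, mul_comm Complex.I,
      Complex.norm_exp_ofReal_mul_I, one_mul]
  · exact Eventually.of_forall fun y => by fun_prop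

/-- The quadratic form `u ↦ ∫ w |û|²` on `L²(Ω)`. -/
noncomputable def spectralForm (Ω : Set (EuclideanSpace ℝ (Fin d)))
    [IsFiniteMeasure (volume.restrict Ω)] (w : EuclideanSpace ℝ (Fin d) → ℝ≥0∞) (u : L2 Ω) :
    ℝ≥0∞ :=
  ∫⁻ ξ, w ξ * ‖⟪planeWave Ω ξ, u⟫_ℂ‖ₑ ^ 2

/-- Dominated convergence: Cauchy–Schwarz gives `|û|² ≤ |Ω| ‖u‖²`, uniformly in `ξ`. -/
theorem continuous_spectralForm [IsFiniteMeasure (volume.restrict Ω)]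
    {w : EuclideanSpace ℝ (Fin d) → ℝ≥0∞} (hw : AEMeasurable w volume)
    (hwi : ∫⁻ ξ, w ξ ≠ ⊤) : Continuous (spectralForm Ω w) := by
  refine SeqContinuous.continuous fun v u hv => ?_
  obtain ⟨M, hM⟩ := hv.norm.bddAbove_range
  have hM' : ∀ n, ‖v n‖ₑ ≤ ENNReal.ofReal M := fun n => by
    rw [← ofReal_norm]
    exact ENNReal.ofReal_le_ofReal (hM ⟨n, rfl⟩)
  refine tendsto_lintegral_of_dominated_convergence'
    (fun ξ => w ξ * (volume Ω * ENNReal.ofReal M ^ 2)) ?_ ?_ ?_ ?_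
  · intro n
    exact hw.mul ((continuous_inner_planeWave (v n)).enorm.measurable.pow_const 2).aemeasurable
  · intro n
    refine Eventually.of_forall fun ξ => ?_
    dsimp only
    gcongr
    rw [← enorm_planeWave_sq ξ, ← mul_pow]
    gcongr
    refine le_trans ?_ (mul_le_mul_right (hM' n) _)
    rw [← ofReal_norm, ← ofReal_norm, ← ofReal_norm, ← ENNReal.ofReal_mul (norm_nonneg _)]
    exact ENNReal.ofReal_le_ofReal (norm_inner_le_norm _ _)
  · have hΩ : volume Ω ≠ ⊤ := by
      rw [← Measure.restrict_apply_univ]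
      exact measure_ne_top _ _
    rw [lintegral_mul_const'' _ hw]
    exact ENNReal.mul_ne_top hwi (ENNReal.mul_ne_top hΩ (ENNReal.pow_ne_top ENNReal.ofReal_ne_top))
  · by_cases h : ∀ᵐ ξ, w ξ ≠ ⊤
    · filter_upwards [h] with ξ hξ
      refine ENNReal.Tendsto.const_mul ?_ (Or.inr hξ)
      exact ((ENNReal.continuous_pow 2).tendsto _).comp (Filter.Tendsto.inner (𝕜 := ℂ) tendsto_const_nhds hv).enorm
    · exact absurd ((ae_lt_top' hw hwi).mono fun ξ h => h.ne) h

theorem lintegral_enorm_test_sq {φ : EuclideanSpace ℝ (Fin d) → ℂ} (hφ : IsTestFunction Ω φ)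
    {u : L2 Ω} (hu : u =ᵐ[volume.restrict Ω] φ) : ∫⁻ x, ‖φ x‖ₑ ^ 2 = ‖u‖ₑ ^ 2 := by
  have h1 := eLpNorm_nnreal_pow_eq_lintegral (f := φ) (μ := volume.restrict Ω) (p := 2) two_ne_zero
  have h2 : ∫⁻ x in Ω, ‖φ x‖ₑ ^ 2 = ∫⁻ x, ‖φ x‖ₑ ^ 2 := by
    refine setLIntegral_eq_of_support_subset fun x hx => ?_
    by_contra h
    exact hx (by simp [hφ.eq_zero_of_notMem h])
  rw [Lp.enorm_def, eLpNorm_congr_ae hu, ← h2]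
  simpa using h1.symm

/-- The inequality is a closed condition on `u`, so test functions suffice. For these, `|Khat|` is
split at level `lam`, and Plancherel evaluates the constant part. -/
theorem IsConvolutionOperator.enorm_inner_le [IsFiniteMeasure (volume.restrict Ω)]
    {K Khat : EuclideanSpace ℝ (Fin d) → ℂ}
    {T : L2 Ω →L[ℂ] L2 Ω} (hΩ : IsOpen Ω) (hT : IsConvolutionOperator Ω K T)
    (hKloc : LocallyIntegrable K volume)
    (hKi : Integrable (fun x => ‖K x‖ * ((1 + ‖x‖) ^ d)⁻¹) volume)
    (hK : IsDistributionalFourierTransform K Khat) (lam : ℝ)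
    (hfin : ∫⁻ ξ, ENNReal.ofReal (‖Khat ξ‖ - lam) ≠ ⊤) (u : L2 Ω) :
    ‖⟪u, T u⟫_ℂ‖ₑ ≤ ENNReal.ofReal (((2 * Real.pi) ^ d)⁻¹) *
      spectralForm Ω (fun ξ => ENNReal.ofReal (‖Khat ξ‖ - lam)) u +
        ENNReal.ofReal lam * ‖u‖ₑ ^ 2 := by
  have hw : AEMeasurable (fun ξ => ENNReal.ofReal (‖Khat ξ‖ - lam)) volume :=
    ((hK.1.aestronglyMeasurable.norm.aemeasurable).sub_const lam).ennreal_ofReal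
  have hcont := continuous_spectralForm (Ω := Ω) hw hfin
  have hclosed : IsClosed {u : L2 Ω | ‖⟪u, T u⟫_ℂ‖ₑ ≤ ENNReal.ofReal (((2 * Real.pi) ^ d)⁻¹) *
      spectralForm Ω (fun ξ => ENNReal.ofReal (‖Khat ξ‖ - lam)) u +
        ENNReal.ofReal lam * ‖u‖ₑ ^ 2} := by
    refine isClosed_le (Continuous.enorm (by fun_prop)) ?_
    refine ((ENNReal.continuous_const_mul ENNReal.ofReal_ne_top).comp hcont).add ?_
    exact (ENNReal.continuous_const_mul ENNReal.ofReal_ne_top).comp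
      ((ENNReal.continuous_pow 2).comp continuous_enorm)
  refine hclosed.closure_subset_iff.2 ?_ (dense_testSubmodule hΩ u)
  rintro u ⟨φ, hφ, hu⟩
  refine (hT.enorm_inner_test_le hKloc hKi hK hφ hu).trans ?_
  have h1 : ENNReal.ofReal (((2 * Real.pi) ^ d)⁻¹) * ∫⁻ ξ, ‖testFourier φ ξ‖ₑ ^ 2 =
      ∫⁻ x, ‖φ x‖ₑ ^ 2 := lintegral_enorm_testFourier_sq hφ.toSchwartz
  rw [← lintegral_enorm_test_sq hφ hu, ← h1, mul_left_comm, ← mul_add]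
  gcongr
  rw [← lintegral_const_mul' _ _ ENNReal.ofReal_ne_top, spectralForm, ← lintegral_add_left']
  · refine lintegral_mono fun ξ => ?_
    rw [inner_planeWave_test hφ hu]
    change _ ≤ ENNReal.ofReal (‖Khat ξ‖ - lam) * ‖testFourier φ ξ‖ₑ ^ 2 +
      ENNReal.ofReal lam * ‖testFourier φ ξ‖ₑ ^ 2
    rw [← add_mul]
    gcongr
    rw [← ofReal_norm]
    exact (ENNReal.ofReal_le_ofReal (by linarith)).trans ENNReal.ofReal_add_le
  · exact hw.mul ((continuous_inner_planeWave u).enorm.measurable.pow_const 2).aemeasurable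

/-- Bessel's inequality for the plane wave at each `ξ`, whose squared norm is `|Ω|`, integrated
against `w`. -/
theorem sum_spectralForm_le [IsFiniteMeasure (volume.restrict Ω)]
    {w : EuclideanSpace ℝ (Fin d) → ℝ≥0∞} (hw : AEMeasurable w volume)
    {ι : Type*} {v : ι → L2 Ω} (hv : Orthonormal ℂ v) (s : Finset ι) :
    ∑ i ∈ s, spectralForm Ω w (v i) ≤ volume Ω * ∫⁻ ξ, w ξ := by
  have hm : ∀ i, Measurable fun ξ => ‖⟪planeWave Ω ξ, v i⟫_ℂ‖ₑ ^ 2 := fun i =>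
    (continuous_inner_planeWave (v i)).enorm.measurable.pow_const 2
  simp_rw [spectralForm]
  rw [← lintegral_finsetSum' (f := fun i ξ => w ξ * ‖⟪planeWave Ω ξ, v i⟫_ℂ‖ₑ ^ 2) s
    fun i _ => hw.mul (hm i).aemeasurable, mul_comm,
    ← lintegral_mul_const'' _ hw]
  refine lintegral_mono fun ξ => ?_
  rw [← Finset.mul_sum]
  gcongr
  have h := hv.sum_inner_products_le (planeWave Ω ξ) (s := s)
  rw [← enorm_planeWave_sq ξ, ← ofReal_norm (planeWave Ω ξ), ← ENNReal.ofReal_pow (norm_nonneg _)]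
  refine le_trans (le_of_eq ?_) (ENNReal.ofReal_le_ofReal h)
  rw [ENNReal.ofReal_sum_of_nonneg fun i _ => by positivity]
  refine Finset.sum_congr rfl fun i _ => ?_
  rw [ENNReal.ofReal_pow (norm_nonneg _), ofReal_norm, ← enorm_norm, norm_inner_symm, enorm_norm]

end QuadraticForm

/-! ### Summation over eigenvalues. -/

section Riesz

open MeasureTheory Filter Topology Set
open scoped ENNReal ContDiff SchwartzMap FourierTransform ComplexConjugate InnerProductSpace

universe u

/-- A finite Hilbert basis spans, since its span is closed; for an infinite one the bound is `⊤`.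
Eigenspaces of infinite dimension are thereby allowed, so compactness plays no role in the Riesz
mean bound. -/
theorem toENat_rank_le_card_hilbertBasis {H ι : Type*} [NormedAddCommGroup H]
    [InnerProductSpace ℂ H] (b : HilbertBasis ι ℂ H) :
    Cardinal.toENat (Module.rank ℂ H) ≤ ENat.card ι := by
  classical
  rcases finite_or_infinite ι with hι | hι
  · have := Fintype.ofFinite ι
    have hfin : FiniteDimensional ℂ (Submodule.span ℂ (range b)) :=
      FiniteDimensional.span_of_finite ℂ (finite_range b)
    have hspan : Submodule.span ℂ (range b) = ⊤ := by
      rw [← b.dense_span, IsClosed.submodule_topologicalClosure_eq]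
      exact Submodule.closed_of_finiteDimensional _
    have h1 := rank_span_le (R := ℂ) (range b)
    rw [hspan, rank_top] at h1
    have h2 := Cardinal.toENat.monotone' h1
    refine h2.trans ?_
    change (range b).encard ≤ _
    rw [← image_univ, ← encard_univ]
    exact encard_image_le _ _
  · simp

/-- Eigenspaces are closed, and mutually orthogonal by self-adjointness, so their Hilbert bases
together form one orthonormal family of eigenvectors. -/
theorem rieszMean_le {H : Type u} [NormedAddCommGroup H] [InnerProductSpace ℂ H]
    [CompleteSpace H] {T : H →L[ℂ] H} (hT : IsSelfAdjoint T) (lam : ℝ) (q : H → ℝ≥0∞) (B : ℝ≥0∞)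
    (hq : ∀ u, ‖u‖ = 1 → ∀ μ : ℂ, T u = μ • u → ENNReal.ofReal (‖μ‖ - lam) ≤ q u)
    (hB : ∀ {ι : Type u} {v : ι → H}, Orthonormal ℂ v → ∀ s : Finset ι, ∑ i ∈ s, q (v i) ≤ B) :
    rieszMean T lam ≤ B := by
  set E : ℂ → Submodule ℂ H := fun μ => Module.End.eigenspace (T : H →ₗ[ℂ] H) μ with hE
  have hclosed : ∀ μ, IsClosed (E μ : Set H) := by
    intro μ
    have : (E μ : Set H) = {u | T u = μ • u} := by
      ext u
      exact Module.End.mem_eigenspace_iff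
    rw [this]
    exact isClosed_eq T.continuous (continuous_const_smul μ)
  have hcomplete : ∀ μ, CompleteSpace (E μ) := fun μ => (hclosed μ).completeSpace_coe
  choose w b hb using fun μ => exists_hilbertBasis ℂ (E μ)
  have horth : Orthonormal ℂ fun p : Σ μ, w μ => ((b p.1 p.2 : E p.1) : H) :=
    (ContinuousLinearMap.isSelfAdjoint_iff_isSymmetric.1 hT).orthogonalFamily_eigenspaces
      |>.orthonormal_sigma_orthonormal (v_family := fun μ => b μ) fun μ => (b μ).orthonormal
  calc rieszMean T lam ≤ ∑' μ : ℂ, ∑' _ : w μ, ENNReal.ofReal (‖μ‖ - lam) := by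
        refine ENNReal.tsum_le_tsum fun μ => ?_
        rw [ENNReal.tsum_const]
        gcongr
        exact toENat_rank_le_card_hilbertBasis (b μ)
    _ = ∑' p : Σ μ, w μ, ENNReal.ofReal (‖p.1‖ - lam) :=
        (ENNReal.tsum_sigma fun μ (_ : w μ) => ENNReal.ofReal (‖μ‖ - lam)).symm
    _ ≤ B := by
        rw [ENNReal.tsum_eq_iSup_sum]
        refine iSup_le fun s => (Finset.sum_le_sum fun p _ => ?_).trans (hB horth s)
        exact hq _ (horth.1 p) p.1 (Module.End.mem_eigenspace_iff.1 (b p.1 p.2).2)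

theorem IsConvolutionOperator.rieszMean_le {d : ℕ} (hd : 1 ≤ d) {α : ℝ} (hα0 : 0 < α) (hαd : α < d)
    {Ω : Set (EuclideanSpace ℝ (Fin d))} (hΩo : IsOpen Ω) (hΩne : Ω.Nonempty)
    (hΩfin : volume Ω < ⊤) {K Khat : EuclideanSpace ℝ (Fin d) → ℂ}
    (hKloc : LocallyIntegrable K volume) (hKhom : IsHomogeneousOfOrder (α - d) K)
    (hKhat : IsDistributionalFourierTransform K Khat)
    {T : L2 Ω →L[ℂ] L2 Ω} (hT : IsConvolutionOperator Ω K T) (hTsa : IsSelfAdjoint T)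
    {lam : ℝ} (hlam : 0 < lam) :
    rieszMean T lam ≤ ENNReal.ofReal (((2 * Real.pi) ^ d)⁻¹) * volume Ω *
      ENNReal.ofReal (lam ^ (1 - d / α)) * ∫⁻ ξ, ENNReal.ofReal (‖Khat ξ‖ - 1) := by
  have : IsFiniteMeasure (volume.restrict Ω) := ⟨by simpa using hΩfin⟩
  rw [mul_assoc, ← hKhat.lintegral_norm_sub hd hα0 hKhom hlam]
  set w : EuclideanSpace ℝ (Fin d) → ℝ≥0∞ := fun ξ => ENNReal.ofReal (‖Khat ξ‖ - lam) with hw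
  have hwm : AEMeasurable w volume :=
    ((hKhat.1.aestronglyMeasurable.norm.aemeasurable).sub_const lam).ennreal_ofReal
  have hc0 : ENNReal.ofReal (((2 * Real.pi) ^ d)⁻¹) ≠ 0 := by
    rw [ne_eq, ENNReal.ofReal_eq_zero, not_le]
    positivity
  by_cases hfin : ∫⁻ ξ, w ξ = ⊤
  -- `⊤` absorbs the product only because the other factors are nonzero; `|Ω| > 0` since `Ω` is open
  -- and nonempty.
  · rw [hfin, ENNReal.mul_top (mul_ne_zero hc0 (hΩo.measure_pos volume hΩne).ne')]
    exact le_top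
  refine _root_.rieszMean_le hTsa lam
    (fun u => ENNReal.ofReal (((2 * Real.pi) ^ d)⁻¹) * spectralForm Ω w u) _ ?_ ?_
  · intro u hu μ hμ
    have h := hT.enorm_inner_le hΩo hKloc (hKhom.integrable_weight hd hαd hKloc) hKhat lam hfin u
    have hu1 : ‖u‖ₑ = 1 := by rw [← ofReal_norm, hu, ENNReal.ofReal_one]
    rw [hμ, inner_smul_right, inner_self_eq_norm_sq_to_K, hu, hu1] at h
    rw [ENNReal.ofReal_sub _ hlam.le, tsub_le_iff_right, ofReal_norm]
    simpa using h
  · intro ι v hv s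
    rw [← Finset.mul_sum, mul_assoc]
    gcongr
    exact sum_spectralForm_le hwm hv s

end Riesz

/-! ### Bounded and compact integral operators. -/

section SchurTest

open MeasureTheory Filter Topology Set
open scoped ENNReal NNReal ComplexConjugate InnerProductSpace

section Schur

variable {X : Type*} [MeasurableSpace X] {μ : Measure X}

/-- Cauchy–Schwarz for `f * g = f ^ (1/2) * (f * g ^ 2) ^ (1/2)`. -/
theorem lintegral_mul_sq_le {f g : X → ℝ≥0∞} (hf : AEMeasurable f μ) (hg : AEMeasurable g μ) :
    (∫⁻ x, f x * g x ∂μ) ^ 2 ≤ (∫⁻ x, f x ∂μ) * ∫⁻ x, f x * g x ^ 2 ∂μ := by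
  have h := ENNReal.lintegral_mul_norm_pow_le (μ := μ) hf (hf.mul (hg.pow_const 2))
    (p := 1 / 2) (q := 1 / 2) (by norm_num) (by norm_num) (by norm_num)
  have h1 : ∀ x, f x ^ (1 / 2 : ℝ) * (f * fun x => g x ^ 2) x ^ (1 / 2 : ℝ) = f x * g x := by
    intro x
    rw [Pi.mul_apply, ← ENNReal.mul_rpow_of_nonneg _ _ (by norm_num)]
    have : f x * (f x * g x ^ 2) = (f x * g x) ^ (2 : ℝ) := by
      rw [ENNReal.rpow_two]
      ring
    rw [this, ← ENNReal.rpow_mul]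
    norm_num
  simp_rw [h1] at h
  rw [← ENNReal.mul_rpow_of_nonneg _ _ (by norm_num)] at h
  calc _ ≤ (((∫⁻ x, f x ∂μ) * ∫⁻ x, (f * fun x => g x ^ 2) x ∂μ) ^ (1 / 2 : ℝ)) ^ 2 := by gcongr
    _ = _ := by
      rw [← ENNReal.rpow_two, ← ENNReal.rpow_mul]
      norm_num

/-- `T` is the integral operator on `L²(μ)` with kernel `k`. -/
def HasKernel (k : X → X → ℂ) (T : Lp ℂ 2 μ →L[ℂ] Lp ℂ 2 μ) : Prop :=
  ∀ u : Lp ℂ 2 μ, ∀ᵐ x ∂μ, Integrable (fun y => k x y * u y) μ ∧ T u x = ∫ y, k x y * u y ∂μ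

theorem HasKernel.add {k l : X → X → ℂ} {S T : Lp ℂ 2 μ →L[ℂ] Lp ℂ 2 μ} (hS : HasKernel k S)
    (hT : HasKernel l T) : HasKernel (k + l) (S + T) := by
  intro u
  filter_upwards [hS u, hT u, Lp.coeFn_add (S u) (T u)] with x hSx hTx hx
  simp only [Pi.add_apply, add_mul]
  refine ⟨hSx.1.add hTx.1, ?_⟩
  rw [integral_add hSx.1 hTx.1, ← hSx.2, ← hTx.2]
  exact hx

theorem HasKernel.unique {k : X → X → ℂ} {S T : Lp ℂ 2 μ →L[ℂ] Lp ℂ 2 μ} (hS : HasKernel k S)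
    (hT : HasKernel k T) : S = T := by
  ext1 u
  refine Lp.ext ?_
  filter_upwards [hS u, hT u] with x hSx hTx
  rw [hSx.2, hTx.2]

variable [SFinite μ]

/-- Schur's test. -/
theorem lintegral_sq_lintegral_kernel_le {k : X → X → ℂ}
    (hk : AEStronglyMeasurable (Function.uncurry k) (μ.prod μ)) {A : ℝ≥0∞}
    (hrow : ∀ᵐ x ∂μ, ∫⁻ y, ‖k x y‖ₑ ∂μ ≤ A) (hcol : ∀ᵐ y ∂μ, ∫⁻ x, ‖k x y‖ₑ ∂μ ≤ A)
    {u : X → ℂ} (hu : AEStronglyMeasurable u μ) :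
    ∫⁻ x, (∫⁻ y, ‖k x y * u y‖ₑ ∂μ) ^ 2 ∂μ ≤ A ^ 2 * ∫⁻ y, ‖u y‖ₑ ^ 2 ∂μ := by
  have hm : AEMeasurable (Function.uncurry fun x y => ‖k x y‖ₑ * ‖u y‖ₑ ^ 2) (μ.prod μ) :=
    hk.enorm.mul ((hu.enorm.comp_snd (μ := μ)).pow_const 2)
  calc _ ≤ ∫⁻ x, A * ∫⁻ y, ‖k x y‖ₑ * ‖u y‖ₑ ^ 2 ∂μ ∂μ := by
        refine lintegral_mono_ae ?_
        filter_upwards [hrow, hk.prodMk_left] with x hx hkx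
        simp_rw [enorm_mul]
        exact (lintegral_mul_sq_le hkx.enorm hu.enorm).trans (mul_le_mul_left hx _)
    _ = A * ∫⁻ y, ∫⁻ x, ‖k x y‖ₑ * ‖u y‖ₑ ^ 2 ∂μ ∂μ := by
        rw [← lintegral_lintegral_swap hm]
        exact lintegral_const_mul'' _ hm.lintegral_prod_right'
    _ ≤ A * ∫⁻ y, A * ‖u y‖ₑ ^ 2 ∂μ := by
        refine mul_le_mul_right (lintegral_mono_ae ?_) _
        filter_upwards [hcol, hk.prod_swap.prodMk_left] with y hy hky
        exact (lintegral_mul_const'' _ hky.enorm).trans_le (mul_le_mul_left hy _)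
    _ = _ := by rw [lintegral_const_mul'' _ (hu.enorm.pow_const 2)]; ring

theorem exists_hasKernel_of_schur {k : X → X → ℂ}
    (hk : AEStronglyMeasurable (Function.uncurry k) (μ.prod μ)) {A : ℝ≥0}
    (hrow : ∀ᵐ x ∂μ, ∫⁻ y, ‖k x y‖ₑ ∂μ ≤ A) (hcol : ∀ᵐ y ∂μ, ∫⁻ x, ‖k x y‖ₑ ∂μ ≤ A) :
    ∃ T : Lp ℂ 2 μ →L[ℂ] Lp ℂ 2 μ, HasKernel k T ∧ ‖T‖ ≤ A := by
  have hsq : ∀ u : X → ℂ, eLpNorm u 2 μ ^ 2 = ∫⁻ x, ‖u x‖ₑ ^ 2 ∂μ := fun u => by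
    simpa using eLpNorm_nnreal_pow_eq_lintegral (f := u) (μ := μ) (p := 2) two_ne_zero
  have hS := fun u : Lp ℂ 2 μ =>
    lintegral_sq_lintegral_kernel_le hk hrow hcol (Lp.aestronglyMeasurable u)
  have hm : ∀ u : Lp ℂ 2 μ,
      AEStronglyMeasurable (fun p : X × X => k p.1 p.2 * u p.2) (μ.prod μ) := fun u =>
    hk.mul ((Lp.aestronglyMeasurable u).comp_snd)
  have hint : ∀ u : Lp ℂ 2 μ, ∀ᵐ x ∂μ, Integrable (fun y => k x y * u y) μ := by
    intro u
    have hfin : ∫⁻ x, (∫⁻ y, ‖k x y * u y‖ₑ ∂μ) ^ 2 ∂μ ≠ ⊤ := by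
      refine ((hS u).trans_lt (ENNReal.mul_lt_top (by simp) ?_)).ne
      rw [← hsq]
      exact ENNReal.pow_lt_top (Lp.eLpNorm_lt_top u)
    filter_upwards [ae_lt_top' ((hm u).enorm.lintegral_prod_right'.pow_const 2) hfin,
      (hm u).prodMk_left] with x hx hx2
    exact ⟨hx2, by simpa [hasFiniteIntegral_iff_enorm] using hx⟩
  have hbound : ∀ u : Lp ℂ 2 μ, eLpNorm (fun x => ∫ y, k x y * u y ∂μ) 2 μ ≤
      A * eLpNorm u 2 μ := by
    intro u
    rw [← ENNReal.pow_le_pow_left_iff two_ne_zero, mul_pow, hsq, hsq]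
    refine le_trans (lintegral_mono fun x => ?_) (hS u)
    gcongr
    exact enorm_integral_le_lintegral_enorm _
  have hmem : ∀ u : Lp ℂ 2 μ, MemLp (fun x => ∫ y, k x y * u y ∂μ) 2 μ := fun u =>
    ⟨(hm u).integral_prod_right',
      (hbound u).trans_lt (ENNReal.mul_lt_top (by simp) (Lp.eLpNorm_lt_top u))⟩
  let T₀ : Lp ℂ 2 μ →ₗ[ℂ] Lp ℂ 2 μ :=
    { toFun := fun u => (hmem u).toLp _
      map_add' := by
        intro u v
        rw [← MemLp.toLp_add]
        refine MemLp.toLp_congr _ _ ?_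
        filter_upwards [hint u, hint v] with x hu hv
        rw [Pi.add_apply, ← integral_add hu hv]
        refine integral_congr_ae ?_
        filter_upwards [Lp.coeFn_add u v] with y hy
        rw [hy, Pi.add_apply, mul_add]
      map_smul' := by
        intro c u
        rw [RingHom.id_apply, ← MemLp.toLp_const_smul]
        refine MemLp.toLp_congr _ _ (Eventually.of_forall fun x => ?_)
        rw [Pi.smul_apply, smul_eq_mul, ← integral_const_mul]
        refine integral_congr_ae ?_
        filter_upwards [Lp.coeFn_smul c u] with y hy
        rw [hy, Pi.smul_apply, smul_eq_mul, mul_left_comm] }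
  have hT₀ : ∀ u, ‖T₀ u‖ ≤ A * ‖u‖ := by
    intro u
    change ‖(hmem u).toLp _‖ ≤ _
    rw [Lp.norm_toLp, Lp.norm_def]
    refine (ENNReal.toReal_mono (ENNReal.mul_ne_top (by simp) (Lp.eLpNorm_ne_top u))
      (hbound u)).trans_eq ?_
    simp
  refine ⟨T₀.mkContinuous A hT₀, fun u => ?_, T₀.mkContinuous_norm_le A.2 hT₀⟩
  filter_upwards [hint u, (hmem u).coeFn_toLp] with x hx hx2
  exact ⟨hx, hx2⟩

end Schur

section HilbertSchmidt

/-- `T` is the operator norm limit of finite-rank partial sums; Cauchy–Schwarz and Bessel bound the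
remainder by the tail of `∑ ‖T (b i)‖ ^ 2`. -/
theorem isCompactOperator_of_summable_norm_sq {ι H H' : Type*} [NormedAddCommGroup H]
    [InnerProductSpace ℂ H] [NormedAddCommGroup H'] [NormedSpace ℂ H'] [CompleteSpace H']
    (b : HilbertBasis ι ℂ H) (T : H →L[ℂ] H') (hT : Summable fun i => ‖T (b i)‖ ^ 2) :
    IsCompactOperator T := by
  classical
  let F : Finset ι → H →L[ℂ] H' := fun s => ∑ i ∈ s, (innerSL ℂ (b i)).smulRight (T (b i))
  have hFapp : ∀ s u, F s u = ∑ i ∈ s, ⟪b i, u⟫_ℂ • T (b i) := fun s u => by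
    simp [F]
  have hF : ∀ s, IsCompactOperator (F s) := by
    intro s
    have : F s ∈ {f : H →L[ℂ] H' | IsCompactOperator f} := by
      refine Finset.sum_induction _ (· ∈ {f : H →L[ℂ] H' | IsCompactOperator f})
        (fun f g hf hg => hf.add hg) isCompactOperator_zero fun i _ => ?_
      change IsCompactOperator fun u => innerSL ℂ (b i) u • T (b i)
      exact (isCompactOperator_id (E := ℂ)).clm_comp ((1 : ℂ →L[ℂ] ℂ).smulRight (T (b i)))
        |>.comp_clm (innerSL ℂ (b i))
    exact this
  refine isCompactOperator_of_tendsto (l := atTop) (F := F) ?_ (Eventually.of_forall hF)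
  rw [Metric.tendsto_atTop]
  intro ε hε
  obtain ⟨s, hs⟩ := summable_iff_vanishing_norm.1 hT ((ε / 2) ^ 2) (by positivity)
  refine ⟨s, fun t hst => ?_⟩
  rw [dist_comm, dist_eq_norm]
  refine lt_of_le_of_lt (ContinuousLinearMap.opNorm_le_bound _ (by positivity) fun u => ?_)
    (half_lt_self hε)
  have hlim : Tendsto (fun r => F r u - F t u) atTop (𝓝 ((T - F t) u)) := by
    have h1 := (b.hasSum_repr u).mapL T
    refine Tendsto.sub_const (Tendsto.congr (fun r => ?_) h1) _
    rw [hFapp]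
    simp [b.repr_apply_apply]
  refine le_of_tendsto hlim.norm ?_
  filter_upwards [eventually_ge_atTop t] with r hr
  have h2 : F r u - F t u = ∑ i ∈ r \ t, ⟪b i, u⟫_ℂ • T (b i) := by
    rw [hFapp, hFapp, ← Finset.sum_sdiff hr, add_sub_cancel_right]
  have h3 : ∑ i ∈ r \ t, ‖T (b i)‖ ^ 2 ≤ (ε / 2) ^ 2 := by
    have := (hs (r \ t) (Finset.sdiff_disjoint.mono_right hst)).le
    rwa [Real.norm_of_nonneg (Finset.sum_nonneg fun i _ => by positivity)] at this
  have h4 : ∑ i ∈ r \ t, ‖⟪b i, u⟫_ℂ‖ ^ 2 ≤ ‖u‖ ^ 2 := b.orthonormal.sum_inner_products_le u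
  rw [h2]
  calc _ ≤ ∑ i ∈ r \ t, ‖⟪b i, u⟫_ℂ‖ * ‖T (b i)‖ := by
        refine (norm_sum_le _ _).trans (Finset.sum_le_sum fun i _ => ?_)
        rw [norm_smul]
    _ ≤ √(∑ i ∈ r \ t, ‖⟪b i, u⟫_ℂ‖ ^ 2) * √(∑ i ∈ r \ t, ‖T (b i)‖ ^ 2) :=
        Real.sum_mul_le_sqrt_mul_sqrt _ _ _
    _ ≤ √(‖u‖ ^ 2) * √((ε / 2) ^ 2) := by gcongr
    _ = _ := by
        rw [Real.sqrt_sq (norm_nonneg _), Real.sqrt_sq (by positivity), mul_comm]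

variable {X : Type*} [MeasurableSpace X] {μ : Measure X}

/-- An integral operator with square integrable kernel is compact. -/
theorem HasKernel.isCompactOperator {k : X → X → ℂ} {T : Lp ℂ 2 μ →L[ℂ] Lp ℂ 2 μ}
    (hT : HasKernel k T) (hk : ∀ᵐ x ∂μ, MemLp (k x) 2 μ)
    (hk2 : ∫⁻ x, eLpNorm (k x) 2 μ ^ 2 ∂μ ≠ ⊤) : IsCompactOperator T := by
  obtain ⟨w, b, -⟩ := exists_hilbertBasis ℂ (Lp ℂ 2 μ)
  refine isCompactOperator_of_summable_norm_sq b T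
    (summable_of_sum_le (c := (∫⁻ x, eLpNorm (k x) 2 μ ^ 2 ∂μ).toReal)
      (fun i => by positivity) fun s => ?_)
  have hsq : ∀ u : Lp ℂ 2 μ, ‖u‖ₑ ^ 2 = ∫⁻ x, ‖u x‖ₑ ^ 2 ∂μ := fun u => by
    rw [Lp.enorm_def]
    simpa using eLpNorm_nnreal_pow_eq_lintegral (f := u) (μ := μ) (p := 2) two_ne_zero
  rw [← ENNReal.ofReal_le_iff_le_toReal hk2,
    ENNReal.ofReal_sum_of_nonneg fun i _ => by positivity]
  simp_rw [ENNReal.ofReal_pow (norm_nonneg _), ofReal_norm, hsq]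
  rw [← lintegral_finsetSum' (f := fun i x => ‖T (b i) x‖ₑ ^ 2) s
    fun i _ => (Lp.aestronglyMeasurable (T (b i))).enorm.pow_const 2]
  refine lintegral_mono_ae ?_
  have hall : ∀ᵐ x ∂μ, ∀ i ∈ s, T (b i) x = ∫ y, k x y * b i y ∂μ :=
    (ae_ball_iff s.countable_toSet).2 fun i _ => (hT (b i)).mono fun x hx => hx.2
  filter_upwards [hk, hall] with x hx hTx
  have hstar : MemLp (fun y => conj (k x y)) 2 μ := hx.star
  set κ : Lp ℂ 2 μ := hstar.toLp _ with hκ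
  -- At fixed `x` these values are coefficients of the conjugated row `k x`, so Bessel bounds the
  -- sum of their squares before integrating in `x`.
  have h1 : ∀ i ∈ s, T (b i) x = ⟪κ, b i⟫_ℂ := by
    intro i hi
    rw [hTx i hi, L2.inner_def]
    refine integral_congr_ae ?_
    filter_upwards [hstar.coeFn_toLp] with y hy
    rw [RCLike.inner_apply, hy, RCLike.conj_conj, mul_comm]
  have h2 := b.orthonormal.sum_inner_products_le κ (s := s)
  have h3 : ‖κ‖ₑ = eLpNorm (k x) 2 μ := by
    rw [hκ, Lp.enorm_toLp]
    exact eLpNorm_congr_norm_ae (Eventually.of_forall fun y => RCLike.norm_conj _)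
  rw [← h3, ← ofReal_norm κ, ← ENNReal.ofReal_pow (norm_nonneg _)]
  refine le_trans (le_of_eq ?_) (ENNReal.ofReal_le_ofReal h2)
  rw [ENNReal.ofReal_sum_of_nonneg fun i _ => by positivity]
  refine Finset.sum_congr rfl fun i hi => ?_
  rw [h1 i hi, ENNReal.ofReal_pow (norm_nonneg _), ofReal_norm, ← enorm_norm, norm_inner_symm,
    enorm_norm]

end HilbertSchmidt

end SchurTest

/-! ### Compactness for kernels bounded on the sphere. -/

section CompactOperator

open MeasureTheory Filter Topology Set
open scoped ENNReal NNReal ComplexConjugate InnerProductSpace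

variable {d : ℕ} {Ω : Set (EuclideanSpace ℝ (Fin d))} {L K : EuclideanSpace ℝ (Fin d) → ℂ}

theorem aestronglyMeasurable_uncurry_sub (hL : AEStronglyMeasurable L volume) :
    AEStronglyMeasurable (Function.uncurry fun x y => L (x - y))
      ((volume.restrict Ω).prod (volume.restrict Ω)) := by
  rw [Measure.prod_restrict]
  exact ((hL.comp_fst (ν := volume)).comp_measurePreserving
    (measurePreserving_sub_prod volume volume)).restrict

theorem setLIntegral_sub_left_le (x : EuclideanSpace ℝ (Fin d)) :
    ∫⁻ y in Ω, ‖L (x - y)‖ₑ ≤ ∫⁻ z, ‖L z‖ₑ :=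
  (setLIntegral_le_lintegral _ _).trans_eq (lintegral_sub_left_eq_self (fun z => ‖L z‖ₑ) x)

theorem setLIntegral_sub_right_le (y : EuclideanSpace ℝ (Fin d)) :
    ∫⁻ x in Ω, ‖L (x - y)‖ₑ ≤ ∫⁻ z, ‖L z‖ₑ :=
  (setLIntegral_le_lintegral _ _).trans_eq (lintegral_sub_right_eq_self (fun z => ‖L z‖ₑ) y)

theorem exists_hasKernel_of_lintegral_le (hL : AEStronglyMeasurable L volume) {A : ℝ≥0}
    (hA : ∫⁻ z, ‖L z‖ₑ ≤ A) :
    ∃ T : L2 Ω →L[ℂ] L2 Ω, HasKernel (fun x y => L (x - y)) T ∧ ‖T‖ ≤ A :=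
  exists_hasKernel_of_schur (aestronglyMeasurable_uncurry_sub hL)
    (Eventually.of_forall fun x => (setLIntegral_sub_left_le x).trans hA)
    (Eventually.of_forall fun y => (setLIntegral_sub_right_le y).trans hA)

theorem exists_hasKernel_isCompactOperator_of_bounded [IsFiniteMeasure (volume.restrict Ω)]
    (hL : AEStronglyMeasurable L volume) {M : ℝ≥0} (hM : ∀ z, ‖L z‖ ≤ M) :
    ∃ T : L2 Ω →L[ℂ] L2 Ω, HasKernel (fun x y => L (x - y)) T ∧ IsCompactOperator T := by
  have hMe : ∀ z, ‖L z‖ₑ ≤ M := fun z => by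
    rw [enorm_eq_nnnorm]
    exact_mod_cast hM z
  set m : ℝ≥0 := (volume.restrict Ω univ).toNNReal
  have hm : (m : ℝ≥0∞) = volume.restrict Ω univ := ENNReal.coe_toNNReal (measure_ne_top _ _)
  have hint : ∀ f : EuclideanSpace ℝ (Fin d) → EuclideanSpace ℝ (Fin d),
      ∫⁻ y in Ω, ‖L (f y)‖ₑ ≤ ((M * m : ℝ≥0) : ℝ≥0∞) := fun f => by
    refine (lintegral_mono fun y => hMe (f y)).trans_eq ?_
    rw [lintegral_const, ENNReal.coe_mul, hm]
  have hk := aestronglyMeasurable_uncurry_sub (Ω := Ω) hL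
  obtain ⟨T, hT, -⟩ := exists_hasKernel_of_schur hk
    (Eventually.of_forall fun x => hint (fun y => x - y))
    (Eventually.of_forall fun y => hint (fun x => x - y))
  refine ⟨T, hT, hT.isCompactOperator ?_ ?_⟩
  · filter_upwards [hk.prodMk_left] with x hx
    exact MemLp.of_bound hx M (Eventually.of_forall fun y => hM _)
  · have hb : ∀ x, eLpNorm (fun y => L (x - y)) 2 (volume.restrict Ω) ≤
        volume.restrict Ω univ ^ ((2 : ℝ≥0∞).toReal)⁻¹ * ENNReal.ofReal M := fun x =>
      eLpNorm_le_of_ae_bound (Eventually.of_forall fun y => hM _)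
    refine ((lintegral_mono fun x => pow_le_pow_left₀ zero_le (hb x) 2).trans_lt ?_).ne
    rw [lintegral_const]
    refine ENNReal.mul_lt_top (ENNReal.pow_lt_top (ENNReal.mul_lt_top ?_ ENNReal.ofReal_lt_top))
      (measure_lt_top _ _)
    exact ENNReal.rpow_lt_top_of_nonneg (by positivity) (measure_ne_top _ _)

theorem IsHomogeneousOfOrder.norm_le {s C : ℝ} (hs : s ≤ 0) (hK : IsHomogeneousOfOrder s K)
    (hC : ∀ x, ‖x‖ = 1 → ‖K x‖ ≤ C) {r : ℝ} (hr : 0 < r) {x : EuclideanSpace ℝ (Fin d)}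
    (hx : r ≤ ‖x‖) : ‖K x‖ ≤ r ^ s * C := by
  have hx0 : 0 < ‖x‖ := hr.trans_le hx
  have hxne : x ≠ 0 := norm_pos_iff.1 hx0
  have h1 : ‖‖x‖⁻¹ • x‖ = 1 := by
    rw [norm_smul, norm_inv, norm_norm, inv_mul_cancel₀ hx0.ne']
  have h2 := hK ‖x‖ hx0 (‖x‖⁻¹ • x) (smul_ne_zero (inv_ne_zero hx0.ne') hxne)
  rw [smul_inv_smul₀ hx0.ne'] at h2
  rw [h2, norm_mul, Complex.norm_real, Real.norm_of_nonneg (by positivity)]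
  exact mul_le_mul (Real.rpow_le_rpow_of_nonpos hr hx hs) (hC _ h1) (norm_nonneg _) (by positivity)

/-- Cut at radius `r`, the part near the origin has norm at most `r ^ α * I.toReal`, which tends to
`0` as `α > 0`, while the part away from it is bounded and compact. The full operator is a norm
limit of compact ones. -/
theorem exists_hasKernel_homogeneous (hd : 1 ≤ d) {α : ℝ} (hα0 : 0 < α) (hαd : α < d)
    [IsFiniteMeasure (volume.restrict Ω)] (hKloc : LocallyIntegrable K volume)
    (hKhom : IsHomogeneousOfOrder (α - d) K) {C : ℝ} (hC : ∀ x, ‖x‖ = 1 → ‖K x‖ ≤ C) :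
    ∃ T : L2 Ω →L[ℂ] L2 Ω, HasKernel (fun x y => K (x - y)) T ∧ IsCompactOperator T := by
  have hKm := hKloc.aestronglyMeasurable
  set I := ∫⁻ x in Metric.ball (0 : EuclideanSpace ℝ (Fin d)) 1, ‖K x‖ₑ
  have hI : I < ⊤ :=
    ((hKloc.integrableOn_isCompact (isCompact_closedBall 0 1)).mono_set
      Metric.ball_subset_closedBall).2
  have hsing : ∀ r : ℝ, 0 < r → ∃ S : L2 Ω →L[ℂ] L2 Ω,
      HasKernel (fun x y => (Metric.ball 0 r).indicator K (x - y)) S ∧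
        ‖S‖ ≤ r ^ α * I.toReal := by
    intro r hr
    have hA : ∫⁻ z, ‖(Metric.ball 0 r).indicator K z‖ₑ ≤
        ((r ^ α * I.toReal).toNNReal : ℝ≥0∞) := by
      simp_rw [enorm_indicator_eq_indicator_enorm]
      rw [lintegral_indicator Metric.isOpen_ball.measurableSet, hKhom.setLIntegral_ball hd hr]
      change _ ≤ ENNReal.ofReal _
      rw [ENNReal.ofReal_mul (by positivity), ENNReal.ofReal_toReal hI.ne]
    obtain ⟨S, hS, hSn⟩ := exists_hasKernel_of_lintegral_le (Ω := Ω)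
      (hKm.indicator Metric.isOpen_ball.measurableSet) hA
    exact ⟨S, hS, hSn.trans_eq (Real.coe_toNNReal _ (by positivity))⟩
  have hreg : ∀ r : ℝ, 0 < r → ∃ S : L2 Ω →L[ℂ] L2 Ω,
      HasKernel (fun x y => (Metric.ball 0 r)ᶜ.indicator K (x - y)) S ∧ IsCompactOperator S := by
    intro r hr
    refine exists_hasKernel_isCompactOperator_of_bounded
      (hKm.indicator Metric.isOpen_ball.measurableSet.compl) (M := (r ^ (α - d) * C).toNNReal) ?_
    intro z
    by_cases hz : z ∈ (Metric.ball (0 : EuclideanSpace ℝ (Fin d)) r)ᶜ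
    · rw [indicator_of_mem hz]
      refine (hKhom.norm_le (by linarith) hC hr ?_).trans (Real.le_coe_toNNReal _)
      simpa using hz
    · rw [indicator_of_notMem hz, norm_zero]
      exact NNReal.coe_nonneg _
  choose! S hS hSn using hsing
  choose! R hR hRc using hreg
  have hsum : ∀ r : ℝ, 0 < r → HasKernel (fun x y => K (x - y)) (R r + S r) := by
    intro r hr
    convert (hR r hr).add (hS r hr) using 1
    ext x y
    exact (congrFun (indicator_compl_add_self (Metric.ball 0 r) K) (x - y)).symm
  refine ⟨R 1 + S 1, hsum 1 one_pos, ?_⟩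
  refine isCompactOperator_of_tendsto (l := 𝓝[>] (0 : ℝ)) (F := R) ?_
    (eventually_mem_nhdsWithin.mono fun r hr => hRc r hr)
  rw [tendsto_iff_norm_sub_tendsto_zero]
  have hlim : Tendsto (fun r : ℝ => r ^ α * I.toReal) (𝓝[>] 0) (𝓝 0) := by
    have h := ((Real.continuousAt_rpow_const 0 α (Or.inr hα0.le)).tendsto.mono_left
      (nhdsWithin_le_nhds (s := Ioi 0))).mul_const I.toReal
    rwa [Real.zero_rpow hα0.ne', zero_mul] at h
  refine squeeze_zero' (Eventually.of_forall fun r => norm_nonneg _)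
    (eventually_mem_nhdsWithin.mono fun r hr => ?_) hlim
  -- The operator was defined by the cut at radius `1`; an operator is determined by its kernel, so
  -- any other radius gives the same one.
  have heq : R 1 + S 1 = R r + S r := (hsum 1 one_pos).unique (hsum r hr)
  rw [heq, sub_add_cancel_left, norm_neg]
  exact hSn r hr

end CompactOperator

theorem mainTheorem6 (d : ℕ) (hd : 1 ≤ d) (α : ℝ) (hα0 : 0 < α) (hαd : α < d)
    (Ω : Set (EuclideanSpace ℝ (Fin d))) (hΩo : IsOpen Ω) (hΩc : IsConnected Ω)
    (hΩfin : volume Ω < ⊤)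
    (K : EuclideanSpace ℝ (Fin d) → ℂ)
    (hKloc : LocallyIntegrable K volume)
    (hKhom : IsHomogeneousOfOrder (α - d) K)
    (hKsymm : ∀ x, x ≠ 0 → K x = (starRingEnd ℂ) (K (-x)))
    (Khat : EuclideanSpace ℝ (Fin d) → ℂ)
    (hKhat : IsDistributionalFourierTransform K Khat) :
    -- the operator is well defined and compact as soon as `K` is bounded on the unit sphere
    ((∃ C : ℝ, ∀ x, ‖x‖ = 1 → ‖K x‖ ≤ C) →
      ∃ T : L2 Ω →L[ℂ] L2 Ω, IsConvolutionOperator Ω K T ∧ IsCompactOperator T) ∧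
    -- it is self-adjoint and its Riesz means satisfy the bound
    ∀ T : L2 Ω →L[ℂ] L2 Ω, IsConvolutionOperator Ω K T →
      IsSelfAdjoint T ∧
      ∀ lam : ℝ, 0 < lam →
        rieszMean T lam ≤
          ENNReal.ofReal (((2 * Real.pi) ^ d)⁻¹) * volume Ω *
            ENNReal.ofReal (lam ^ (1 - d / α)) *
              ∫⁻ ξ, ENNReal.ofReal (‖Khat ξ‖ - 1) := by

  have hfin : IsFiniteMeasure (volume.restrict Ω) := ⟨by simpa using hΩfin⟩
  -- For Lebesgue measure restricted to `Ω`, `HasKernel` unfolds definitionally to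
  -- `IsConvolutionOperator`.
  refine ⟨fun ⟨C, hC⟩ => exists_hasKernel_homogeneous hd hα0 hαd hKloc hKhom hC, fun T hT => ?_⟩
  have hsa := hT.isSelfAdjoint hd hΩo hKloc hKsymm
  exact ⟨hsa, fun lam hlam =>
    hT.rieszMean_le hd hα0 hαd hΩo hΩc.nonempty hΩfin hKloc hKhom hKhat hsa hlam⟩
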